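/- **Model.** Let $n\ge 1$, $\lambda\in(0,1)$. There are $n$ parallel servers with infinite FIFO queues; server $i$ works at rate $\mu_i$, where $\mu=(\mu_1,\dots,\mu_n)\in\Sigma_n=\{\mu\in(0,\infty)^n:\sum_i\mu_i=n\}$. Jobs arrive as a renewal process of rate $\lambda n$ (i.i.d. interarrival times with law $G_n$ of mean $1/(\lambda n)$) at times $T_1\le T_2\le\dots$; their sizes $W_1,W_2,\dots\ge 0$ are i.i.d. with law $F$ (not depending on $n$) of mean $1$. A dispatcher has a memory with states $\mathcal M=\{1,\dots,2^{c}\}$ ($c$ bits). $\mathcal Q$ is the set of finite sequences of nonnegative reals, the remaining workloads of the jobs of a queue in order of arrival. A *memory-based dispatching policy* consists of a rate $\beta\ge 0$ and measurable functions $f_1,f_2,f_3,g_1,g_2,g_3,h_1,h_2$ used as follows, where $M(t)$ is the memory state, $Q_i(t)\in\mathcal Q$ the state of queue $i$, $t^-$ denotes the state just before the event, and $U_{j,k}$ ($1\le j\le 8$, $k\ge1$) are independent uniform variables on $[0,1]$; arrivals, sizes, the Poisson process below and the $U_{j,k}$ are independent. * *Arrival of job $k$* (at $t=T_k$): the set $S_k=f_1(M(t^-),W_k,U_{1,k})$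 of servers is queried ($2|S_k|$ messages); with $B=\{(Q_i(t^-),\mu_i,i):i\in S_k\}$ the job joins queue $D_k=f_2(M(t^-),W_k,B,U_{2,k})$, and $M(t)=f_3(M(t^-),W_k,B,D_k,U_{3,k})$. * *$k$-th event of a Poisson process of rate $\beta$* (at time $t$): if $g_1(Q(t),\mu,U_{4,k})=0$ nothing happens. If it equals a server $i$, then server $i$ sends a message, the servers in $S^s_k=g_2(M(t^-),i,Q_i(t),\mu_i,U_{5,k})$ are queried ($1+2|S^s_k|$ messages), and $M(t)=g_3(M(t^-),i,Q_i(t),\mu_i,\{(Q_j(t),\mu_j,j):j\in S^s_k\},U_{6,k})$. * *$k$-th service completion in the system* (at server $i$, time $t$; $Q_i(t)$ is the queue after the departure): if $h_1(Q_i(t),\mu_i,U_{7,k})=1$, server $i$ sends one message and $M(t)=h_2(M(t^-),i,Q_i(t),\mu_i,U_{8,k})$; otherwise no message is sent and $M$ is unchanged. Of simultaneous events, arrivals come first, and service completions are taken in the order of the servers. Let $Z(t)$ be the time elapsed since the last arrival. The process $(Q(t),M(t),Z(t))_{t\ge0}$ is started from a state $(q,m,z)$ with no finished job at the head of a queue and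 $G_n((z,\infty))>0$ (the first interarrival time, begun at time $-z$, is conditioned to exceed $z$); the initial state may be random, independent of everything else apart from this conditioning. The *average message rate* is $\limsup_{t\to\infty}\frac1t\cdot$(number of messages exchanged in $[0,t]$). The *stability region* of the policy is the set of $\mu\in\Sigma_n$ for which $(Q,M,Z)$ is positive Harris recurrent: there is a nonzero $\sigma$-finite measure $\varphi$ on the state space such that every measurable $A$ with $\varphi(A)>0$ is occupied for an infinite total time, almost surely from every initial state, and there is an invariant probability measure. The policy is *weakly symmetric* if for every permutation $\sigma$ of the servers there is a permutation $\sigma_M$ of $\mathcal M$ such that, for $U$ uniform on $[0,1]$ and all $m\in\mathcal M$, $w\ge0$, $S\subset\{1,\dots,n\}$, $q\in\mathcal Q^n$, $\mu\in[0,\infty)^n$, $$\sigma\big(f_1(m,w,U)\big)\overset d= f_1(\sigma_M(m),w,U),$$ $$\sigma\big(f_2(m,w,\{(q_i,\mu_i,i):i\in S\},U)\big)\overset d= f_2\big(\sigma_M(m),w,\{(q_i,\mu_i,\sigma(i)):i\in S\},U\big).$$ **Theorem.** Fix $\lambda\in(0,1)$. Below, an *admissible sequence* consists of a positive sequence $(\alpha_n)_{n\ge1}$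 with $\alpha_n=o(n^2)$, laws $F$ and $(G_n)$ as above, weakly symmetric policies for $n=1,2,\dots$ servers with $c_n=o(\log n)$ bits of memory, and, for each $n$ and $\mu\in\Sigma_n$, a law of the initial state under which the average message rate is almost surely at most $\alpha_n$. 1. There are sets $\Gamma_n(\lambda,r)\subsetneq\Sigma_n$ ($n\ge1$, $r>0$), depending only on $n$, $\lambda$ and $r$, such that for every admissible sequence the stability region of the $n$-th policy is contained in $\Gamma_n(\lambda,\alpha_n)$ for all large $n$. 2. For every job size law $F$ there are constants $a,K>0$ depending only on $\lambda$ and $F$ such that, with $b_n=a\,e^{-K\alpha_n/n}$, the following holds for every admissible sequence with job size law $F$ and all large $n$. If $\mu\in\Sigma_n$ and $\lfloor n/2\rfloor$ servers have the same rate $\mu_i=\varepsilon$, then the total remaining workload $\mathcal W(t)$ satisfies $$\liminf_{t\to\infty}\frac{\mathcal W(t)}{t}\ \ge\ (b_n-\varepsilon)\,n\qquad\text{almost surely};$$ and if $\varepsilon<b_n$, then $\mu$ is not in the stability region, i.e. the process is not positive Harris recurrent. -/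

import Mathlib

open MeasureTheory ProbabilityTheory Filter Asymptotics
open scoped NNReal ENNReal

namespace Dispatch

/-- State of one FIFO queue: the remaining workloads of its jobs, in order of arrival, the job in
service first. An idle server has the empty list. -/
abbrev Queue : Type := List ℝ≥0

/-- The coproduct σ-algebra on the disjoint union of the spaces `ℝ₊ᵏ`, generated by the number of
jobs and by the sequence of remaining workloads (continued by zeros). -/
instance instMeasurableSpaceQueue : MeasurableSpace (List ℝ≥0) :=
  MeasurableSpace.comap (fun l : List ℝ≥0 => (l.length, fun j : ℕ => l.getD j 0)) inferInstance

/-- The coproduct σ-algebra on `Option β`. -/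
instance instMeasurableSpaceOption {β : Type*} [m : MeasurableSpace β] :
    MeasurableSpace (Option β) :=
  MeasurableSpace.map some m

/-- What the dispatcher learns from the queried servers: a set of triples (queue state, service
rate, server) with distinct servers, that is, a partial function on the servers. -/
abbrev Report (n : ℕ) : Type := Fin n → Option (Queue × ℝ≥0)

/-- The set `{(q i, μ i, i) : i ∈ S}`. -/
def report {n : ℕ} (q : Fin n → Queue) (μ : Fin n → ℝ≥0) (S : Finset (Fin n)) : Report n :=
  fun i => if i ∈ S then some (q i, μ i) else none

/-- Replace every triple `(q, μ, i)` by `(q, μ, σ i)`. -/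
def Report.relabel {n : ℕ} (σ : Equiv.Perm (Fin n)) (r : Report n) : Report n :=
  fun i => r (σ.symm i)

/-- A memory-based dispatching policy for `n` servers with `c` bits of memory. -/
structure Policy (n c : ℕ) where
  /-- Rate of the Poisson process of potential spontaneous messages. -/
  β : ℝ≥0
  /-- Servers queried at an arrival: memory, job size, randomization. -/
  f₁ : Fin (2 ^ c) → ℝ≥0 → unitInterval → Finset (Fin n)
  /-- Destination of the job: memory, job size, answers, randomization. -/
  f₂ : Fin (2 ^ c) → ℝ≥0 → Report n → unitInterval → Fin n
  /-- Memory update at an arrival: memory, job size, answers, destination, randomization. -/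
  f₃ : Fin (2 ^ c) → ℝ≥0 → Report n → Fin n → unitInterval → Fin (2 ^ c)
  /-- Sender of a spontaneous message (`none` if nobody sends one). -/
  g₁ : (Fin n → Queue) → (Fin n → ℝ≥0) → unitInterval → Option (Fin n)
  /-- Servers queried at a spontaneous message: memory, sender, its queue and rate. -/
  g₂ : Fin (2 ^ c) → Fin n → Queue → ℝ≥0 → unitInterval → Finset (Fin n)
  /-- Memory update at a spontaneous message. -/
  g₃ : Fin (2 ^ c) → Fin n → Queue → ℝ≥0 → Report n → unitInterval → Fin (2 ^ c)
  /-- Whether a server sends a message at a service completion. -/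
  h₁ : Queue → ℝ≥0 → unitInterval → Bool
  /-- Memory update at a message sent at a service completion. -/
  h₂ : Fin (2 ^ c) → Fin n → Queue → ℝ≥0 → unitInterval → Fin (2 ^ c)
  measurable_f₁ : Measurable fun x : Fin (2 ^ c) × ℝ≥0 × unitInterval => f₁ x.1 x.2.1 x.2.2
  measurable_f₂ : Measurable fun x : Fin (2 ^ c) × ℝ≥0 × Report n × unitInterval =>
    f₂ x.1 x.2.1 x.2.2.1 x.2.2.2
  measurable_f₃ : Measurable fun x : Fin (2 ^ c) × ℝ≥0 × Report n × Fin n × unitInterval =>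
    f₃ x.1 x.2.1 x.2.2.1 x.2.2.2.1 x.2.2.2.2
  measurable_g₁ : Measurable fun x : (Fin n → Queue) × (Fin n → ℝ≥0) × unitInterval =>
    g₁ x.1 x.2.1 x.2.2
  measurable_g₂ : Measurable fun x : Fin (2 ^ c) × Fin n × Queue × ℝ≥0 × unitInterval =>
    g₂ x.1 x.2.1 x.2.2.1 x.2.2.2.1 x.2.2.2.2
  measurable_g₃ : Measurable fun x : Fin (2 ^ c) × Fin n × Queue × ℝ≥0 × Report n × unitInterval =>
    g₃ x.1 x.2.1 x.2.2.1 x.2.2.2.1 x.2.2.2.2.1 x.2.2.2.2.2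
  measurable_h₁ : Measurable fun x : Queue × ℝ≥0 × unitInterval => h₁ x.1 x.2.1 x.2.2
  measurable_h₂ : Measurable fun x : Fin (2 ^ c) × Fin n × Queue × ℝ≥0 × unitInterval =>
    h₂ x.1 x.2.1 x.2.2.1 x.2.2.2.1 x.2.2.2.2

/-- Weak symmetry. Equality in distribution of the finitely-valued `f₁`, `f₂` is equality of all
point probabilities with respect to a uniform variable on `[0, 1]`. -/
def Policy.WeaklySymmetric {n c : ℕ} (P : Policy n c) : Prop :=
  ∀ σ : Equiv.Perm (Fin n), ∃ σM : Equiv.Perm (Fin (2 ^ c)),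
    (∀ (m : Fin (2 ^ c)) (w : ℝ≥0) (S : Finset (Fin n)),
      volume {u : unitInterval | (P.f₁ m w u).map σ.toEmbedding = S} =
        volume {u : unitInterval | P.f₁ (σM m) w u = S}) ∧
    (∀ (m : Fin (2 ^ c)) (w : ℝ≥0) (S : Finset (Fin n)) (q : Fin n → Queue) (μ : Fin n → ℝ≥0)
      (i : Fin n),
      volume {v : unitInterval | σ (P.f₂ m w (report q μ S) v) = i} =
        volume {v : unitInterval | P.f₂ (σM m) w ((report q μ S).relabel σ) v = i})

/-- Positive service rates with total `n`. -/
def rateSet (n : ℕ) : Set (Fin n → ℝ≥0) :=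
  {μ | (∀ i, 0 < μ i) ∧ ∑ i, μ i = n}

/-! ### Fundamental processes -/

/-- Sample space: interarrival times, normalized gaps between spontaneous message events, job
sizes, and eight sequences of randomization variables. -/
abbrev Sample : Type := (ℕ → ℝ≥0) × (ℕ → ℝ≥0) × (ℕ → ℝ≥0) × (Fin 8 → ℕ → unitInterval)

/-- The exponential law with mean one. -/
noncomputable def unitExp : Measure ℝ≥0 := (expMeasure 1).map Real.toNNReal

/-- All coordinates independent: interarrival times of law `G`, unit exponential gaps, job sizes of
law `F`, uniform randomization variables. -/
noncomputable def baseLaw (G F : Measure ℝ≥0) : Measure Sample :=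
  (Measure.infinitePi fun _ : ℕ => G).prod
    ((Measure.infinitePi fun _ : ℕ => unitExp).prod
      ((Measure.infinitePi fun _ : ℕ => F).prod
        (Measure.pi fun _ : Fin 8 => Measure.infinitePi fun _ : ℕ => (volume : Measure unitInterval))))

/-- The law of the fundamental processes when the time elapsed since the previous arrival is `z` at
time zero: the current interarrival time is conditioned to exceed `z`. -/
noncomputable def lawFrom (G F : Measure ℝ≥0) (z : ℝ≥0) : Measure Sample :=
  (baseLaw G F)[|{ω : Sample | z < ω.1 0}]

/-- Time of arrival number `k` (from `0`), when the previous arrival was at time `-z`. -/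
noncomputable def arrivalTime (z : ℝ≥0) (ω : Sample) (k : ℕ) : ℝ≥0 :=
  (∑ j ∈ Finset.range (k + 1), ω.1 j) - z

/-- Time of event number `k` (from `0`) of the Poisson process of rate `β` (`∞` if `β = 0`). -/
noncomputable def messageTime (β : ℝ≥0) (ω : Sample) (k : ℕ) : ℝ≥0∞ :=
  ((∑ j ∈ Finset.range (k + 1), ω.2.1 j : ℝ≥0) : ℝ≥0∞) / (β : ℝ≥0∞)

def jobSize (ω : Sample) (k : ℕ) : ℝ≥0 := ω.2.2.1 k

/-- The randomization variable written `U_{j+1,k+1}` when numbering starts from one. -/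
def unif (ω : Sample) (j : Fin 8) (k : ℕ) : unitInterval := ω.2.2.2 j k

/-! ### Sample paths -/

/-- Values of the process: queues, memory, time elapsed since the previous arrival. -/
abbrev State (n c : ℕ) : Type := (Fin n → Queue) × Fin (2 ^ c) × ℝ≥0

/-- Apply the amount `x` of service to the first job. -/
noncomputable def serve (x : ℝ≥0) : Queue → Queue
  | [] => []
  | w :: l => (w - x) :: l

/-- Evolution during a time `d` without events. -/
noncomputable def flow {n c : ℕ} (μ : Fin n → ℝ≥0) (d : ℝ≥0) (s : State n c) : State n c :=
  (fun i => serve (μ i * d) (s.1 i), s.2.1, s.2.2 + d)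

/-- Time until the next service completion at a server of rate `r` (`∞` if idle). -/
noncomputable def completionDelay (r : ℝ≥0) : Queue → ℝ≥0∞
  | [] => ⊤
  | w :: _ => (w : ℝ≥0∞) / (r : ℝ≥0∞)

/-- Situation just after an event: its time, the state, the numbers of past arrivals, of past events
of the spontaneous message process and of past departures, and the number of messages exchanged. -/
structure Config (n c : ℕ) where
  time : ℝ≥0
  state : State n c
  arr : ℕ
  spon : ℕ
  dep : ℕ
  msgs : ℕ

/-- Arrival of a job at time `t`. -/
noncomputable def onArrival {n c : ℕ} (P : Policy n c) (μ : Fin n → ℝ≥0) (ω : Sample) (t : ℝ≥0)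
    (C : Config n c) : Config n c :=
  let s := flow μ (t - C.time) C.state
  let q := s.1
  let m := s.2.1
  let w := jobSize ω C.arr
  let S := P.f₁ m w (unif ω 0 C.arr)
  let D := P.f₂ m w (report q μ S) (unif ω 1 C.arr)
  { time := t
    state := (Function.update q D (q D ++ [w]),
      P.f₃ m w (report q μ S) D (unif ω 2 C.arr), 0)
    arr := C.arr + 1
    spon := C.spon
    dep := C.dep
    msgs := C.msgs + 2 * S.card }

/-- Event of the spontaneous message process at time `t`. -/
noncomputable def onMessage {n c : ℕ} (P : Policy n c) (μ : Fin n → ℝ≥0) (ω : Sample) (t : ℝ≥0)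
    (C : Config n c) : Config n c :=
  let s := flow μ (t - C.time) C.state
  let q := s.1
  let m := s.2.1
  match P.g₁ q μ (unif ω 3 C.spon) with
  | none => { C with time := t, state := s, spon := C.spon + 1 }
  | some i =>
    let S := P.g₂ m i (q i) (μ i) (unif ω 4 C.spon)
    { time := t
      state := (q, P.g₃ m i (q i) (μ i) (report q μ S) (unif ω 5 C.spon), s.2.2)
      arr := C.arr
      spon := C.spon + 1
      dep := C.dep
      msgs := C.msgs + (1 + 2 * S.card) }

/-- Service completion at server `i` at time `t`. Departures are numbered jointly over all servers,
so that each of them uses fresh randomization variables. -/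
noncomputable def onDeparture {n c : ℕ} (P : Policy n c) (μ : Fin n → ℝ≥0) (ω : Sample) (i : Fin n)
    (t : ℝ≥0) (C : Config n c) : Config n c :=
  let s := flow μ (t - C.time) C.state
  let q := Function.update s.1 i (s.1 i).tail
  let m := s.2.1
  let b := P.h₁ (q i) (μ i) (unif ω 6 C.dep)
  { time := t
    state := (q, if b then P.h₂ m i (q i) (μ i) (unif ω 7 C.dep) else m, s.2.2)
    arr := C.arr
    spon := C.spon
    dep := C.dep + 1
    msgs := C.msgs + if b then 1 else 0 }

open Classical in
/-- The next event. If several are due at the same time, an arrival (which acts on the left limits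
of the processes) comes first, and departures are taken in the order of the servers. -/
noncomputable def step {n c : ℕ} (P : Policy n c) (μ : Fin n → ℝ≥0) (z : ℝ≥0) (ω : Sample)
    (C : Config n c) : Config n c :=
  let ta : ℝ≥0 := arrivalTime z ω C.arr
  let ts : ℝ≥0∞ := messageTime P.β ω C.spon
  let td : Fin n → ℝ≥0∞ := fun i => C.time + completionDelay (μ i) (C.state.1 i)
  if (ta : ℝ≥0∞) ≤ ts ∧ ∀ i, (ta : ℝ≥0∞) ≤ td i then onArrival P μ ω ta C
  else if ∀ i, ts ≤ td i then onMessage P μ ω ts.toNNReal C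
  else
    match (List.finRange n).find? (fun i => decide (∀ j, td i ≤ td j)) with
    | none => C
    | some i => onDeparture P μ ω i (td i).toNNReal C

/-- Situation after the first `k` events, from the initial state `x`. -/
noncomputable def configAfter {n c : ℕ} (P : Policy n c) (μ : Fin n → ℝ≥0) (x : State n c)
    (ω : Sample) (k : ℕ) : Config n c :=
  (step P μ x.2.2 ω)^[k] ⟨0, x, 0, 0, 0, 0⟩

/-- Number of events in `[0, t]`. -/
noncomputable def eventCount {n c : ℕ} (P : Policy n c) (μ : Fin n → ℝ≥0) (x : State n c)
    (t : ℝ≥0) (ω : Sample) : ℕ :=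
  sSup {k : ℕ | (configAfter P μ x ω k).time ≤ t}

/-- Situation just after the last event in `[0, t]`. -/
noncomputable def configAt {n c : ℕ} (P : Policy n c) (μ : Fin n → ℝ≥0) (x : State n c)
    (t : ℝ≥0) (ω : Sample) : Config n c :=
  configAfter P μ x ω (eventCount P μ x t ω)

/-- The process `(Q(t), M(t), Z(t))` started from `x`. -/
noncomputable def process {n c : ℕ} (P : Policy n c) (μ : Fin n → ℝ≥0) (x : State n c)
    (t : ℝ≥0) (ω : Sample) : State n c :=
  flow μ (t - (configAt P μ x t ω).time) (configAt P μ x t ω).state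

/-- Total remaining workload at time `t`. -/
noncomputable def totalWorkload {n c : ℕ} (P : Policy n c) (μ : Fin n → ℝ≥0) (x : State n c)
    (t : ℝ≥0) (ω : Sample) : ℝ≥0 :=
  ∑ i, ((process P μ x t ω).1 i).sum

/-- Average message rate between the dispatcher and the servers. -/
noncomputable def messageRate {n c : ℕ} (P : Policy n c) (μ : Fin n → ℝ≥0) (x : State n c)
    (ω : Sample) : ℝ≥0∞ :=
  limsup (fun t : ℝ≥0 => ((configAt P μ x t ω).msgs : ℝ≥0∞) / (t : ℝ≥0∞)) atTop

/-- Lower growth rate of the total workload. -/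
noncomputable def workloadGrowth {n c : ℕ} (P : Policy n c) (μ : Fin n → ℝ≥0) (x : State n c)
    (ω : Sample) : ℝ≥0∞ :=
  liminf (fun t : ℝ≥0 => (totalWorkload P μ x t ω : ℝ≥0∞) / (t : ℝ≥0∞)) atTop

/-! ### Stability -/

/-- State space of the process for interarrival law `G`: no finished job at the head of a queue, and
an elapsed time that the interarrival time exceeds with positive probability. -/
def stateSpace (n c : ℕ) (G : Measure ℝ≥0) : Set (State n c) :=
  {x | (∀ i, (x.1 i).head? ≠ some 0) ∧ 0 < G (Set.Ioi x.2.2)}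

/-- Positive Harris recurrence of the process `X x` with law `Pr x`, `x ∈ E`: sets of positive
`φ`-measure are visited for an infinite time, almost surely and from every state, and there is an
invariant probability measure. -/
def PositiveHarrisRecurrent {Ω E₀ : Type*} [MeasurableSpace Ω] [MeasurableSpace E₀] (E : Set E₀)
    (Pr : E₀ → Measure Ω) (X : E₀ → ℝ≥0 → Ω → E₀) : Prop :=
  (∃ φ : Measure E₀, SigmaFinite φ ∧ φ ≠ 0 ∧ φ Eᶜ = 0 ∧
    ∀ A : Set E₀, MeasurableSet A → 0 < φ A →
      ∀ x ∈ E, ∀ᵐ ω ∂(Pr x), volume {t : ℝ | 0 ≤ t ∧ X x t.toNNReal ω ∈ A} = ⊤) ∧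
  (∃ π : Measure E₀, IsProbabilityMeasure π ∧ π Eᶜ = 0 ∧
    ∀ (t : ℝ≥0) (A : Set E₀), MeasurableSet A →
      ∫⁻ x, Pr x {ω | X x t ω ∈ A} ∂π = π A)

/-- Service rate vectors for which the process is positive Harris recurrent, for interarrival law
`G` and job size law `F`. -/
def stabilityRegion {n c : ℕ} (P : Policy n c) (G F : Measure ℝ≥0) : Set (Fin n → ℝ≥0) :=
  {μ | μ ∈ rateSet n ∧
    PositiveHarrisRecurrent (stateSpace n c G) (fun x => lawFrom G F x.2.2) (process P μ)}

/-- A sequence of weakly symmetric policies `P n` with `c n = o(log n)` bits of memory, for renewal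
arrivals of rate `lam * n` and i.i.d. job sizes of mean one, whose average message rate, from initial
states of law `ν n μ`, is almost surely at most `α n = o(n ^ 2)`. -/
structure Admissible (lam : ℝ) (α : ℕ+ → ℝ) (F : Measure ℝ≥0) (G : ℕ+ → Measure ℝ≥0) (c : ℕ+ → ℕ)
    (P : ∀ n : ℕ+, Policy n (c n))
    (ν : ∀ n : ℕ+, (Fin n → ℝ≥0) → Measure (State n (c n))) : Prop where
  job_prob : IsProbabilityMeasure F
  job_mean : ∫⁻ w, (w : ℝ≥0∞) ∂F = 1
  arrival_prob : ∀ n, IsProbabilityMeasure (G n)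
  arrival_mean : ∀ n, ∫⁻ y, (y : ℝ≥0∞) ∂(G n) = ENNReal.ofReal (1 / (lam * (n : ℕ)))
  symmetric : ∀ n, (P n).WeaklySymmetric
  memory : (fun n : ℕ+ => (c n : ℝ)) =o[atTop] fun n : ℕ+ => Real.log (n : ℕ)
  message_pos : ∀ n, 0 < α n
  message_order : α =o[atTop] fun n : ℕ+ => ((n : ℕ) : ℝ) ^ 2
  initial_prob : ∀ n : ℕ+, ∀ μ ∈ rateSet n, IsProbabilityMeasure (ν n μ)
  initial_mem : ∀ n : ℕ+, ∀ μ ∈ rateSet n, ∀ᵐ x ∂(ν n μ), x ∈ stateSpace n (c n) (G n)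
  message_rate : ∀ n : ℕ+, ∀ μ ∈ rateSet n, ∀ᵐ x ∂(ν n μ), ∀ᵐ ω ∂(lawFrom (G n) F x.2.2),
    messageRate (P n) μ x ω ≤ ENNReal.ofReal (α n)

end Dispatch

/-!
The relabellings of the servers that do not affect the decisions in a given memory state form a
group of index at most the number of memory states. If this number is less than `n`, the group
contains the alternating group. Hence, given its size, the queried set is uniformly distributed,
and the servers that are not queried are exchangeable. Whatever the memory state, a job for which
`q ≤ n / 4` servers are queried therefore joins a given half of the servers with probability at
least `4 ^ (-q) / 4`. This bound is convex in `q`, so it lies above its tangent at the mean number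
of queries that the message rate allows: the indicator that a job joins that half, plus a multiple
of its number of queries, has a conditional mean bounded below by a constant. Conditional means
given the past are computed by resampling the randomness of one job, and the Azuma–Hoeffding
inequality with the Borel–Cantelli lemma turns the bound into linear growth of the number of jobs
sent to the half along almost every path. If the half is slower than this bound, its workload
grows linearly, so sets of bounded workload are not visited for an infinite time. A single rate
vector, with an exponentially small rate on half of the servers, then lies outside every stability
region.
-/

namespace Dispatch

/-! ### Weak symmetry -/

section

open Equiv.Perm in
theorem alternatingGroup_le_of_index_lt {α : Type*} [Fintype α] [DecidableEq α]
    (hα : 5 ≤ Nat.card α) {H : Subgroup (Equiv.Perm α)} (hH : H.index < Nat.card α) :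
    alternatingGroup α ≤ H := by
  suffices Nontrivial H.normalCore from
    (alternatingGroup_le_of_normal hα this).trans H.normalCore_le
  rw [Subgroup.nontrivial_iff_ne_bot]
  intro hbot
  -- A trivial normal core embeds the symmetric group into the permutations of the cosets of `H`.
  rw [Subgroup.normalCore_eq_ker, MonoidHom.ker_eq_bot_iff] at hbot
  have hcard := Nat.card_le_card_of_injective _ hbot
  rw [Nat.card_perm, Nat.card_perm, ← Subgroup.index_eq_card] at hcard
  exact hcard.not_gt ((Nat.factorial_lt (Nat.pos_of_ne_zero H.index_ne_zero_of_finite)).2 hH)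

theorem exists_mem_alternatingGroup_apply_eq {α : Type*} [Fintype α] [DecidableEq α]
    {S : Finset α} (hS : S.card + 3 ≤ Fintype.card α) {i j : α} (hi : i ∉ S) (hj : j ∉ S) :
    ∃ τ ∈ alternatingGroup α, τ i = j ∧ ∀ x ∈ S, τ x = x := by
  rcases eq_or_ne i j with rfl | hij
  · exact ⟨1, one_mem _, rfl, fun _ _ => rfl⟩
  obtain ⟨k, hk⟩ : ∃ k, k ∉ insert i (insert j S) := by
    by_contra! hall
    have hcard := Finset.card_le_card fun x (_ : x ∈ Finset.univ) => hall x
    have := Finset.card_insert_le i (insert j S)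
    have := Finset.card_insert_le j S
    rw [Finset.card_univ] at hcard
    lia
  simp only [Finset.mem_insert, not_or] at hk
  obtain ⟨hki, hkj, hkS⟩ := hk
  refine ⟨Equiv.swap i k * Equiv.swap i j, Equiv.Perm.mul_mem_alternatingGroup_of_isSwap
    ⟨i, k, Ne.symm hki, rfl⟩ ⟨i, j, hij, rfl⟩, ?_, fun x hx => ?_⟩
  · simp [Equiv.swap_apply_of_ne_of_ne, hij.symm, Ne.symm hkj]
  · have hxi : x ≠ i := ne_of_mem_of_not_mem hx hi
    have hxj : x ≠ j := ne_of_mem_of_not_mem hx hj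
    have hxk : x ≠ k := ne_of_mem_of_not_mem hx hkS
    simp [Equiv.swap_apply_of_ne_of_ne, hxi, hxj, hxk]

variable {n c : ℕ}

theorem Report.relabel_mul (σ τ : Equiv.Perm (Fin n)) (r : Report n) :
    r.relabel (σ * τ) = (r.relabel τ).relabel σ := rfl

theorem Report.exists_eq_report (r : Report n) : ∃ q μ S, r = report q μ S := by
  refine ⟨fun i => ((r i).getD ([], 0)).1, fun i => ((r i).getD ([], 0)).2,
    Finset.univ.filter fun i => r i ≠ none, funext fun i => ?_⟩
  cases h : r i <;> simp [report, h]

theorem relabel_report_of_forall_apply_eq {S : Finset (Fin n)} {τ : Equiv.Perm (Fin n)}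
    (hτ : ∀ i ∈ S, τ i = i) (q : Fin n → Queue) (μ : Fin n → ℝ≥0) :
    (report q μ S).relabel τ = report q μ S := by
  funext i
  by_cases hi : i ∈ S
  · simp [Report.relabel, report, hi, τ.symm_apply_eq.2 (hτ i hi).symm]
  · have hi' : τ.symm i ∉ S := fun h => by
      have hfix := hτ _ h
      rw [τ.apply_symm_apply] at hfix
      exact hi (hfix ▸ h)
    simp [Report.relabel, report, hi, hi']

/-- The probability that the set `S` of servers is queried at the arrival of a job of size `w`. -/
noncomputable def Policy.queryProb (P : Policy n c) (m : Fin (2 ^ c)) (w : ℝ≥0)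
    (S : Finset (Fin n)) : ℝ :=
  volume.real {u : unitInterval | P.f₁ m w u = S}

/-- The probability that a job of size `w` joins queue `i` when the queried servers answer `r`. -/
noncomputable def Policy.sendProb (P : Policy n c) (m : Fin (2 ^ c)) (w : ℝ≥0) (r : Report n)
    (i : Fin n) : ℝ :=
  volume.real {v : unitInterval | P.f₂ m w r v = i}

/-- In memory state `m'`, the policy decides as in memory state `m` with the servers relabelled
by `σ`: the relation between states that weak symmetry provides. -/
def Policy.IsRelabelling (P : Policy n c) (σ : Equiv.Perm (Fin n)) (m m' : Fin (2 ^ c)) : Prop :=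
  ∀ w, (∀ S, P.queryProb m' w (S.map σ.toEmbedding) = P.queryProb m w S) ∧
    ∀ r i, P.sendProb m' w (r.relabel σ) (σ i) = P.sendProb m w r i

namespace Policy

variable {P : Policy n c} {m m' m'' : Fin (2 ^ c)} {σ τ : Equiv.Perm (Fin n)}

theorem IsRelabelling.one : P.IsRelabelling 1 m m := fun w =>
  ⟨fun _ => congrArg (P.queryProb m w) Finset.map_refl, fun _ _ => rfl⟩

theorem IsRelabelling.mul (hσ : P.IsRelabelling σ m' m'') (hτ : P.IsRelabelling τ m m') :
    P.IsRelabelling (σ * τ) m m'' := fun w => by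
  refine ⟨fun S => ?_, fun r i => ?_⟩
  · rw [← (hτ w).1, ← (hσ w).1, Finset.map_map]
    rfl
  · rw [Report.relabel_mul, Equiv.Perm.mul_apply, (hσ w).2, (hτ w).2]

theorem IsRelabelling.inv (hσ : P.IsRelabelling σ m m') : P.IsRelabelling σ⁻¹ m' m := fun w => by
  refine ⟨fun S => ?_, fun r i => ?_⟩
  · rw [← (hσ w).1, Finset.map_map]
    congr 1
    ext
    simp
  · have hi : σ (σ⁻¹ i) = i := σ.apply_symm_apply i
    rw [← (hσ w).2, ← Report.relabel_mul, mul_inv_cancel, hi]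
    rfl

theorem WeaklySymmetric.exists_isRelabelling (hP : P.WeaklySymmetric) (σ : Equiv.Perm (Fin n))
    (m : Fin (2 ^ c)) : ∃ m', P.IsRelabelling σ m m' := by
  obtain ⟨σM, hquery, hsend⟩ := hP σ
  refine ⟨σM m, fun w => ⟨fun S => ?_, fun r i => ?_⟩⟩
  · have := hquery m w (S.map σ.toEmbedding)
    simp only [(Finset.map_injective σ.toEmbedding).eq_iff] at this
    simp only [queryProb, measureReal_def, this]
  · obtain ⟨q, μ, S, rfl⟩ := r.exists_eq_report
    have := hsend m w S q μ (σ i)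
    simp only [σ.injective.eq_iff] at this
    simp only [sendProb, measureReal_def, this]

variable (P m) in
/-- The relabellings of the servers that do not affect the decisions in memory state `m`. -/
def symmetryGroup : Subgroup (Equiv.Perm (Fin n)) where
  carrier := {σ | P.IsRelabelling σ m m}
  mul_mem' := IsRelabelling.mul
  one_mem' := IsRelabelling.one
  inv_mem' := IsRelabelling.inv

theorem WeaklySymmetric.index_symmetryGroup_le (hP : P.WeaklySymmetric) (m : Fin (2 ^ c)) :
    (P.symmetryGroup m).index ≤ 2 ^ c := by
  choose M hM using fun σ => hP.exists_isRelabelling σ m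
  have hinj : Function.Injective fun x : Equiv.Perm (Fin n) ⧸ P.symmetryGroup m => M x.out := by
    intro x y hxy
    rw [← x.out_eq', ← y.out_eq']
    refine QuotientGroup.eq.2 ((hM x.out).inv.mul ?_)
    exact (show M x.out = M y.out from hxy) ▸ hM y.out
  rw [Subgroup.index_eq_card]
  simpa using Nat.card_le_card_of_injective _ hinj

theorem WeaklySymmetric.isRelabelling_of_mem_alternatingGroup (hP : P.WeaklySymmetric)
    (hn : 5 ≤ n) (hc : 2 ^ c < n) (m : Fin (2 ^ c)) (hσ : σ ∈ alternatingGroup (Fin n)) :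
    P.IsRelabelling σ m m := by
  refine alternatingGroup_le_of_index_lt (H := P.symmetryGroup m) (by simpa using hn) ?_ hσ
  simpa using (hP.index_symmetryGroup_le m).trans_lt hc

theorem WeaklySymmetric.queryProb_eq_of_card_eq (hP : P.WeaklySymmetric) (hn : 5 ≤ n)
    (hc : 2 ^ c < n) (m : Fin (2 ^ c)) (w : ℝ≥0) {S T : Finset (Fin n)} (h : S.card = T.card) :
    P.queryProb m w S = P.queryProb m w T := by
  have := Set.powersetCard.isPretransitive_alternatingGroup (α := Fin n) (n := T.card)
    (by rw [Nat.card_fin]; lia)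
  obtain ⟨g, hg⟩ := this.exists_smul_eq ⟨S, h⟩ ⟨T, rfl⟩
  have hgS : S.map (g : Equiv.Perm (Fin n)).toEmbedding = T := by
    rw [Finset.map_eq_image]
    exact congrArg Subtype.val hg
  rw [← hgS, ((hP.isRelabelling_of_mem_alternatingGroup hn hc m g.2) w).1]

theorem WeaklySymmetric.sendProb_eq_of_notMem (hP : P.WeaklySymmetric) (hn : 5 ≤ n)
    (hc : 2 ^ c < n) (m : Fin (2 ^ c)) (w : ℝ≥0) {S : Finset (Fin n)} (hS : S.card + 3 ≤ n)
    (q : Fin n → Queue) (μ : Fin n → ℝ≥0) {i j : Fin n} (hi : i ∉ S) (hj : j ∉ S) :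
    P.sendProb m w (report q μ S) i = P.sendProb m w (report q μ S) j := by
  obtain ⟨τ, hτ, rfl, hfix⟩ :=
    exists_mem_alternatingGroup_apply_eq (by simpa using hS) hi hj
  rw [← ((hP.isRelabelling_of_mem_alternatingGroup hn hc m hτ) w).2,
    relabel_report_of_forall_apply_eq hfix]

end Policy

end

/-! ### The probability of joining one of half of the queues -/

section

theorem choose_le_pow_mul_choose {n k a s : ℕ} (h : ∀ j < s, n - j ≤ a * (k - j)) :
    n.choose s ≤ a ^ s * k.choose s := by
  have hdesc : n.descFactorial s ≤ a ^ s * k.descFactorial s := by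
    calc n.descFactorial s = ∏ j ∈ Finset.range s, (n - j) := n.descFactorial_eq_prod_range s
      _ ≤ ∏ j ∈ Finset.range s, a * (k - j) :=
          Finset.prod_le_prod' fun j hj => h j (Finset.mem_range.1 hj)
      _ = a ^ s * k.descFactorial s := by
          rw [Finset.prod_mul_distrib, Finset.prod_const, Finset.card_range,
            k.descFactorial_eq_prod_range]
  rw [Nat.descFactorial_eq_factorial_mul_choose, Nat.descFactorial_eq_factorial_mul_choose,
    Nat.mul_left_comm] at hdesc
  exact Nat.le_of_mul_le_mul_left hdesc s.factorial_pos

theorem sum_mul_quarter_pow_le_sum_powerset {n : ℕ} (hn : 8 ≤ n) {N : Finset (Fin n)}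
    (hN : n ≤ 2 * N.card + 1) {p : Finset (Fin n) → ℝ} (hp : ∀ S, 0 ≤ p S)
    (hcard : p.FactorsThrough Finset.card) :
    ∑ S, p S * (if 4 * S.card ≤ n then (1 / 4 : ℝ) ^ S.card else 0) ≤
      ∑ S ∈ N.powerset, if 4 * S.card ≤ n then p S else 0 := by
  obtain ⟨g, rfl⟩ := (Function.factorsThrough_iff p).1 hcard
  have hNn : N.card ≤ n := by simpa using N.card_le_univ
  simp only [Function.comp_apply] at hp ⊢
  rw [← Finset.powerset_univ,
    Finset.sum_powerset_apply_card fun s => g s * (if 4 * s ≤ n then (1 / 4 : ℝ) ^ s else 0),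
    Finset.sum_powerset_apply_card fun s => if 4 * s ≤ n then g s else 0, Finset.card_fin,
    Finset.sum_subset (Finset.range_subset_range.2 (Nat.succ_le_succ hNn))]
  · refine Finset.sum_le_sum fun s hs => ?_
    split_ifs with h
    · obtain ⟨S, -, rfl⟩ := Finset.exists_subset_card_eq (show s ≤ N.card by lia)
      have hchoose : (n.choose S.card : ℝ) ≤ 4 ^ S.card * N.card.choose S.card := by
        exact_mod_cast choose_le_pow_mul_choose (fun j hj => by lia)
      calc n.choose S.card • (g S.card * (1 / 4 : ℝ) ^ S.card)
          = g S.card * (n.choose S.card / 4 ^ S.card) := by simp; ring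
        _ ≤ g S.card * N.card.choose S.card := by
            refine mul_le_mul_of_nonneg_left ((div_le_iff₀' (by positivity)).2 hchoose) (hp S)
        _ = N.card.choose S.card • g S.card := by simp [mul_comm]
    · simp
  · intro s _ hs
    rw [Nat.choose_eq_zero_of_lt (by simpa using hs), zero_nsmul]

theorem integral_comp_eq_sum {ι Ω : Type*} [Fintype ι] [MeasurableSpace ι]
    [MeasurableSingletonClass ι] [MeasurableSpace Ω] {μ : Measure Ω} [IsFiniteMeasure μ]
    {g : Ω → ι} (hg : Measurable g) (h : ι → ℝ) :
    ∫ x, h (g x) ∂μ = ∑ i, μ.real {x | g x = i} * h i := by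
  rw [← integral_map hg.aemeasurable (measurable_of_countable h).aestronglyMeasurable,
    integral_fintype .of_finite]
  refine Finset.sum_congr rfl fun i _ => ?_
  rw [map_measureReal_apply hg (measurableSet_singleton i), smul_eq_mul]
  rfl

variable {n c : ℕ}

namespace Policy

theorem queryProb_nonneg (P : Policy n c) (m : Fin (2 ^ c)) (w : ℝ≥0) (S : Finset (Fin n)) :
    0 ≤ P.queryProb m w S :=
  measureReal_nonneg

theorem sendProb_nonneg (P : Policy n c) (m : Fin (2 ^ c)) (w : ℝ≥0) (r : Report n) (i : Fin n) :
    0 ≤ P.sendProb m w r i :=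
  measureReal_nonneg

theorem integral_comp_f₁ (P : Policy n c) (m : Fin (2 ^ c)) (w : ℝ≥0)
    (h : Finset (Fin n) → ℝ) : ∫ u, h (P.f₁ m w u) = ∑ S, P.queryProb m w S * h S :=
  integral_comp_eq_sum (P.measurable_f₁.comp
    (measurable_const.prodMk (measurable_const.prodMk measurable_id))) h

theorem integral_comp_f₂ (P : Policy n c) (m : Fin (2 ^ c)) (w : ℝ≥0) (r : Report n)
    (h : Fin n → ℝ) : ∫ v, h (P.f₂ m w r v) = ∑ i, P.sendProb m w r i * h i :=
  integral_comp_eq_sum (P.measurable_f₂.comp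
    (measurable_const.prodMk (measurable_const.prodMk (measurable_const.prodMk measurable_id)))) h

theorem sum_queryProb (P : Policy n c) (m : Fin (2 ^ c)) (w : ℝ≥0) :
    ∑ S, P.queryProb m w S = 1 := by
  simpa using (P.integral_comp_f₁ m w fun _ => 1).symm

theorem sum_sendProb (P : Policy n c) (m : Fin (2 ^ c)) (w : ℝ≥0) (r : Report n) :
    ∑ i, P.sendProb m w r i = 1 := by
  simpa using (P.integral_comp_f₂ m w r fun _ => 1).symm

/-- The probability that a job of size `w` joins a queue in `N` when the servers in `S` are
queried. -/
noncomputable def sendProbOn (P : Policy n c) (m : Fin (2 ^ c)) (w : ℝ≥0) (q : Fin n → Queue)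
    (μ : Fin n → ℝ≥0) (N S : Finset (Fin n)) : ℝ :=
  ∑ i ∈ N, P.sendProb m w (report q μ S) i

theorem sendProbOn_nonneg (P : Policy n c) (m : Fin (2 ^ c)) (w : ℝ≥0) (q : Fin n → Queue)
    (μ : Fin n → ℝ≥0) (N S : Finset (Fin n)) : 0 ≤ P.sendProbOn m w q μ N S :=
  Finset.sum_nonneg fun i _ => P.sendProb_nonneg m w _ i

theorem integral_f₂_mem (P : Policy n c) (m : Fin (2 ^ c)) (w : ℝ≥0) (q : Fin n → Queue)
    (μ : Fin n → ℝ≥0) (N S : Finset (Fin n)) :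
    ∫ v, (if P.f₂ m w (report q μ S) v ∈ N then (1 : ℝ) else 0) = P.sendProbOn m w q μ N S := by
  rw [P.integral_comp_f₂ m w (report q μ S) fun i => if i ∈ N then (1 : ℝ) else 0]
  simp [sendProbOn, Finset.sum_ite_mem]

variable {P : Policy n c}

theorem WeaklySymmetric.quarter_le_sendProbOn (hP : P.WeaklySymmetric) (hn : 8 ≤ n)
    (hc : 2 ^ c < n) (m : Fin (2 ^ c)) (w : ℝ≥0) (q : Fin n → Queue) (μ : Fin n → ℝ≥0)
    {N S : Finset (Fin n)} (hN : n ≤ 2 * N.card + 1) (hSN : S ⊆ N) (hS : 4 * S.card ≤ n) :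
    1 / 4 ≤ P.sendProbOn m w q μ N S := by
  obtain ⟨j, -, hjS⟩ := Finset.exists_mem_notMem_of_card_lt_card (show S.card < N.card by lia)
  set f := P.sendProb m w (report q μ S) with hf
  have hconst : ∀ T : Finset (Fin n), S ⊆ T →
      ∑ i ∈ T, f i = ∑ i ∈ S, f i + (T.card - S.card : ℝ) * f j := fun T hST => by
    have hout : ∀ i ∈ T \ S, f i = f j := fun i hi =>
      hP.sendProb_eq_of_notMem (by lia) hc m w (by lia) q μ (Finset.mem_sdiff.1 hi).2 hjS
    rw [← Finset.sum_sdiff hST, add_comm, Finset.sum_congr rfl hout, Finset.sum_const,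
      Finset.card_sdiff_of_subset hST, nsmul_eq_mul, Nat.cast_sub (Finset.card_le_card hST)]
  have htotal : ∑ i ∈ S, f i + (n - S.card : ℝ) * f j = 1 := by
    rw [← P.sum_sendProb m w (report q μ S), ← hf, hconst _ S.subset_univ, Finset.card_fin]
  have hfS : 0 ≤ ∑ i ∈ S, f i := Finset.sum_nonneg fun i _ => P.sendProb_nonneg m w _ i
  have hcard : (n + 3 * S.card : ℝ) ≤ 4 * N.card := by
    exact_mod_cast (by lia : n + 3 * S.card ≤ 4 * N.card)
  rw [sendProbOn, hconst N hSN]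
  nlinarith [mul_nonneg (sub_nonneg.2 hcard) (P.sendProb_nonneg m w (report q μ S) j)]

end Policy

/-- The tangent line at `x₀` of the decreasing convex function `x ↦ 4⁻ˣ / 4` is
`x ↦ tangentIntercept x₀ - tangentSlope x₀ * x`. -/
noncomputable def tangentSlope (x₀ : ℝ) : ℝ := 4 ^ (-x₀) / 4 * Real.log 4

/-- The value at zero of the tangent line at `x₀` of `x ↦ 4⁻ˣ / 4`; see `tangentSlope`. -/
noncomputable def tangentIntercept (x₀ : ℝ) : ℝ := 4 ^ (-x₀) / 4 * (1 + Real.log 4 * x₀)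

theorem tangentSlope_pos (x₀ : ℝ) : 0 < tangentSlope x₀ :=
  mul_pos (by positivity) (Real.log_pos (by norm_num))

theorem one_lt_log_four : 1 < Real.log 4 := by
  rw [Real.lt_log_iff_exp_lt (by norm_num)]
  linarith [Real.exp_one_lt_d9]

theorem tangent_le_quarter_pow (x₀ : ℝ) (s : ℕ) :
    tangentIntercept x₀ - tangentSlope x₀ * s ≤ (1 / 4) ^ s / 4 := by
  have hpow : (1 / 4 : ℝ) ^ s = 4 ^ (-x₀) * Real.exp (Real.log 4 * (x₀ - s)) := by
    rw [Real.rpow_def_of_pos (by norm_num), ← Real.exp_add, one_div, inv_pow, ← Real.rpow_natCast,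
      ← Real.rpow_neg (by norm_num), Real.rpow_def_of_pos (by norm_num)]
    ring_nf
  have hexp := Real.add_one_le_exp (Real.log 4 * (x₀ - s))
  calc tangentIntercept x₀ - tangentSlope x₀ * s
      = 4 ^ (-x₀) * (Real.log 4 * (x₀ - s) + 1) / 4 := by
        rw [tangentIntercept, tangentSlope]; ring
    _ ≤ (1 / 4) ^ s / 4 := by rw [hpow]; gcongr

theorem tangent_nonpos {x₀ x : ℝ} (h : x₀ + 1 ≤ x) :
    tangentIntercept x₀ - tangentSlope x₀ * x ≤ 0 := by
  calc tangentIntercept x₀ - tangentSlope x₀ * x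
      = 4 ^ (-x₀) / 4 * (1 - Real.log 4 * (x - x₀)) := by rw [tangentIntercept, tangentSlope]; ring
    _ ≤ 0 := mul_nonpos_of_nonneg_of_nonpos (by positivity) (by nlinarith [one_lt_log_four])

namespace Policy

variable {P : Policy n c}

theorem WeaklySymmetric.sum_powerset_le_sum_mul_sendProbOn (hP : P.WeaklySymmetric) (hn : 8 ≤ n)
    (hc : 2 ^ c < n) (m : Fin (2 ^ c)) (w : ℝ≥0) (q : Fin n → Queue) (μ : Fin n → ℝ≥0)
    {N : Finset (Fin n)} (hN : n ≤ 2 * N.card + 1) :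
    (∑ S ∈ N.powerset, if 4 * S.card ≤ n then P.queryProb m w S else 0) / 4 ≤
      ∑ S, P.queryProb m w S * P.sendProbOn m w q μ N S := by
  have hnonneg : ∀ S, 0 ≤ P.queryProb m w S * P.sendProbOn m w q μ N S := fun S =>
    mul_nonneg (P.queryProb_nonneg m w S) (P.sendProbOn_nonneg m w q μ N S)
  rw [Finset.sum_div]
  refine (Finset.sum_le_sum fun S hS => ?_).trans
    (Finset.sum_le_sum_of_subset_of_nonneg N.powerset.subset_univ fun S _ _ => hnonneg S)
  split_ifs with h
  · rw [div_eq_mul_one_div]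
    exact mul_le_mul_of_nonneg_left (hP.quarter_le_sendProbOn hn hc m w q μ hN
      (Finset.mem_powerset.1 hS) h) (P.queryProb_nonneg m w S)
  · rw [zero_div]
    exact hnonneg S

theorem WeaklySymmetric.tangentIntercept_le_sum (hP : P.WeaklySymmetric) (hn : 8 ≤ n)
    (hc : 2 ^ c < n) (m : Fin (2 ^ c)) (w : ℝ≥0) (q : Fin n → Queue) (μ : Fin n → ℝ≥0)
    {N : Finset (Fin n)} (hN : n ≤ 2 * N.card + 1) {x₀ : ℝ} (hx₀ : x₀ + 1 ≤ n / 4) :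
    tangentIntercept x₀ ≤
      ∑ S, P.queryProb m w S * (P.sendProbOn m w q μ N S + tangentSlope x₀ * S.card) := by
  set p := P.queryProb m w
  have htangent : ∀ S : Finset (Fin n), tangentIntercept x₀ - tangentSlope x₀ * S.card ≤
      (if 4 * S.card ≤ n then (1 / 4 : ℝ) ^ S.card else 0) / 4 := fun S => by
    split_ifs with h
    · exact tangent_le_quarter_pow x₀ S.card
    · rw [zero_div]
      refine tangent_nonpos (hx₀.trans ?_)
      rw [div_le_iff₀' (by norm_num)]
      exact_mod_cast (not_le.1 h).le
  have hsend := hP.sum_powerset_le_sum_mul_sendProbOn hn hc m w q μ hN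
  have hquery := sum_mul_quarter_pow_le_sum_powerset hn hN (P.queryProb_nonneg m w)
    fun S T h => hP.queryProb_eq_of_card_eq (by lia) hc m w h
  calc tangentIntercept x₀
      = ∑ S, p S * (tangentIntercept x₀ - tangentSlope x₀ * S.card) +
          ∑ S, p S * (tangentSlope x₀ * S.card) := by
        simp_rw [mul_sub, Finset.sum_sub_distrib, sub_add_cancel, ← Finset.sum_mul]
        rw [P.sum_queryProb, one_mul]
    _ ≤ ∑ S, p S * ((if 4 * S.card ≤ n then (1 / 4 : ℝ) ^ S.card else 0) / 4) +
          ∑ S, p S * (tangentSlope x₀ * S.card) := by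
        gcongr with S
        · exact P.queryProb_nonneg m w S
        · exact htangent S
    _ ≤ ∑ S, p S * P.sendProbOn m w q μ N S + ∑ S, p S * (tangentSlope x₀ * S.card) := by
        simp_rw [← mul_div_assoc, ← Finset.sum_div]
        linarith
    _ = _ := by simp_rw [← Finset.sum_add_distrib, mul_add]

theorem WeaklySymmetric.tangentIntercept_le_integral (hP : P.WeaklySymmetric) (hn : 8 ≤ n)
    (hc : 2 ^ c < n) (m : Fin (2 ^ c)) (w : ℝ≥0) (q : Fin n → Queue) (μ : Fin n → ℝ≥0)
    {N : Finset (Fin n)} (hN : n ≤ 2 * N.card + 1) {x₀ : ℝ} (hx₀ : x₀ + 1 ≤ n / 4) :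
    tangentIntercept x₀ ≤
      ∫ u, ((∫ v, (if P.f₂ m w (report q μ (P.f₁ m w u)) v ∈ N then (1 : ℝ) else 0)) +
        tangentSlope x₀ * (P.f₁ m w u).card) := by
  simp_rw [integral_f₂_mem]
  rw [P.integral_comp_f₁ m w fun S => P.sendProbOn m w q μ N S + tangentSlope x₀ * S.card]
  exact hP.tangentIntercept_le_sum hn hc m w q μ hN hx₀

end Policy

end

/-! ### Measurability of the sample paths -/

section

variable {n c : ℕ} {α β : Type*} [MeasurableSpace α] [MeasurableSpace β]

section Index

variable {ι : Type*} [Countable ι] [MeasurableSpace ι] [MeasurableSingletonClass ι]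

theorem measurable_of_index {g : α → ι} (hg : Measurable g) {h : α → β}
    (H : ∀ i, ∃ f : α → β, Measurable f ∧ ∀ a, g a = i → h a = f a) : Measurable h := by
  choose f hf hfh using H
  have hjoint : Measurable fun x : ι × α => f x.1 x.2 := measurable_from_prod_countable_right hf
  have heq : h = fun a => f (g a) a := funext fun a => hfh _ a rfl
  rw [heq]
  exact hjoint.comp (hg.prodMk measurable_id)

theorem measurable_comp_index {f : ι → α → β} {g : α → ι} (hf : ∀ i, Measurable (f i))
    (hg : Measurable g) : Measurable fun a => f (g a) a :=
  measurable_of_index hg fun i => ⟨f i, hf i, fun a ha => by rw [ha]⟩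

theorem measurable_apply_index {q : α → ι → β} {D : α → ι} (hq : Measurable q)
    (hD : Measurable D) : Measurable fun a => q a (D a) :=
  measurable_comp_index (f := fun i a => q a i) (fun i => (measurable_pi_apply i).comp hq) hD

theorem measurable_update_index [DecidableEq ι] {q : α → ι → β} {D : α → ι} {y : α → β}
    (hq : Measurable q) (hD : Measurable D) (hy : Measurable y) :
    Measurable fun a => Function.update (q a) (D a) (y a) := by
  refine measurable_comp_index (f := fun i a => Function.update (q a) i (y a))
    (fun i => measurable_pi_lambda _ fun j => ?_) hD
  rcases eq_or_ne j i with rfl | h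
  · simpa using hy
  · simp only [Function.update_of_ne h]
    exact (measurable_pi_apply j).comp hq

end Index

theorem measurable_queue_iff {f : α → Queue} :
    Measurable f ↔ (Measurable fun a => (f a).length) ∧
      ∀ j, Measurable fun a => (f a).getD j 0 := by
  rw [measurable_comap_iff]
  exact ⟨fun h => ⟨h.fst, fun j => (measurable_pi_apply j).comp h.snd⟩,
    fun h => h.1.prodMk (measurable_pi_lambda _ h.2)⟩

@[fun_prop]
theorem measurable_serve {x : α → ℝ≥0} {q : α → Queue} (hx : Measurable x) (hq : Measurable q) :
    Measurable fun a => serve (x a) (q a) := by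
  obtain ⟨hlength, hgetD⟩ := measurable_queue_iff.1 hq
  refine measurable_queue_iff.2 ⟨?_, fun j => ?_⟩
  · convert hlength using 2 with a
    cases q a <;> rfl
  · cases j with
    | zero =>
      have hsub : ∀ a, (serve (x a) (q a)).getD 0 0 = (q a).getD 0 0 - x a := fun a => by
        cases q a with
        | nil => exact (zero_tsub (x a)).symm
        | cons w l => rfl
      simp only [hsub]
      exact (hgetD 0).sub hx
    | succ j =>
      convert hgetD (j + 1) using 2 with a
      cases q a <;> rfl

@[fun_prop]
theorem measurable_append_singleton {w : α → ℝ≥0} {q : α → Queue} (hw : Measurable w)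
    (hq : Measurable q) : Measurable fun a => q a ++ [w a] := by
  obtain ⟨hlength, hgetD⟩ := measurable_queue_iff.1 hq
  refine measurable_queue_iff.2 ⟨?_, fun j => ?_⟩
  · simp only [List.length_append, List.length_singleton]
    exact hlength.add_const 1
  · have hgetD_append : ∀ a, (q a ++ [w a]).getD j 0 =
        if j < (q a).length then (q a).getD j 0 else if j = (q a).length then w a else 0 := by
      intro a
      split_ifs with hlt heq
      · rw [List.getD_append _ _ _ _ hlt]
      · rw [List.getD_append_right _ _ _ _ heq.ge, heq, Nat.sub_self]
        rfl
      · exact List.getD_eq_default _ _ (by simp; lia)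
    simp only [hgetD_append]
    exact Measurable.ite (hlength (measurableSet_Ioi (a := j))) (hgetD j)
      (Measurable.ite (measurableSet_eq_fun measurable_const hlength) hw measurable_const)

@[fun_prop]
theorem measurable_tail {q : α → Queue} (hq : Measurable q) : Measurable fun a => (q a).tail := by
  obtain ⟨hlength, hgetD⟩ := measurable_queue_iff.1 hq
  refine measurable_queue_iff.2 ⟨?_, fun j => ?_⟩
  · simp only [List.length_tail]
    exact (measurable_of_countable fun k : ℕ => k - 1).comp hlength
  · convert hgetD (j + 1) using 2 with a
    cases q a <;> rfl

@[fun_prop]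
theorem measurable_queue_sum : Measurable fun q : Queue => q.sum := by
  obtain ⟨hlength, hgetD⟩ := measurable_queue_iff.1 (measurable_id (α := Queue))
  have hsum : ∀ q : Queue, q.sum = ∑ j ∈ Finset.range q.length, q.getD j 0 := by
    intro q
    induction q with
    | nil => simp
    | cons w l ih =>
      rw [List.sum_cons, ih, List.length_cons, Finset.sum_range_succ']
      exact add_comm _ _
  simp only [hsum]
  exact measurable_comp_index (f := fun k (q : Queue) => ∑ j ∈ Finset.range k, q.getD j 0)
    (fun k => Finset.measurable_sum _ fun j _ => hgetD j) hlength

@[fun_prop]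
theorem measurable_completionDelay (r : ℝ≥0) {q : α → Queue} (hq : Measurable q) :
    Measurable fun a => completionDelay r (q a) := by
  obtain ⟨hlength, hgetD⟩ := measurable_queue_iff.1 hq
  have hdelay : ∀ a, completionDelay r (q a) =
      if (q a).length = 0 then ⊤ else ((q a).getD 0 0 : ℝ≥0∞) / (r : ℝ≥0∞) := by
    intro a
    cases q a <;> rfl
  simp only [hdelay]
  exact Measurable.ite (measurableSet_eq_fun hlength measurable_const) measurable_const
    ((hgetD 0).coe_nnreal_ennreal.div measurable_const)

theorem measurable_some : Measurable (some : β → Option β) :=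
  fun _ hs => hs

instance instMeasurableSingletonClassOption [MeasurableSingletonClass β] :
    MeasurableSingletonClass (Option β) where
  measurableSet_singleton x := by
    change MeasurableSet (some ⁻¹' {x})
    cases x with
    | none => convert MeasurableSet.empty; ext; simp
    | some y => convert measurableSet_singleton y; ext; simp

@[fun_prop]
theorem measurable_report {q : α → Fin n → Queue} {S : α → Finset (Fin n)} (μ : Fin n → ℝ≥0)
    (hq : Measurable q) (hS : Measurable S) : Measurable fun a => report (q a) μ (S a) := by
  refine measurable_comp_index (f := fun S a => report (q a) μ S)
    (fun S => measurable_pi_lambda _ fun i => ?_) hS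
  by_cases hi : i ∈ S
  · simp only [report, if_pos hi]
    exact measurable_some.comp (by fun_prop)
  · simp only [report, if_neg hi]
    exact measurable_const

theorem measurable_find? {ι : Type*} [MeasurableSpace ι] {p : α → ι → Bool}
    (hp : ∀ i, Measurable fun a => p a i) (l : List ι) : Measurable fun a => l.find? (p a) := by
  induction l with
  | nil => simp
  | cons i l ih =>
    have hfind : ∀ a, (i :: l).find? (p a) =
        if p a i = true then some i else l.find? (p a) := fun a => by
      cases h : p a i <;> simp [h]
    simp only [hfind]
    exact Measurable.ite (measurableSet_eq_fun (hp i) measurable_const) measurable_const ih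

section Sample

variable {ω : α → Sample} {k : α → ℕ}

@[fun_prop]
theorem measurable_arrivalTime (z : ℝ≥0) (hω : Measurable ω) (hk : Measurable k) :
    Measurable fun a => arrivalTime z (ω a) (k a) :=
  measurable_comp_index (f := fun k a => arrivalTime z (ω a) k)
    (fun k => (Finset.measurable_sum _ fun j _ => by fun_prop).sub_const z) hk

@[fun_prop]
theorem measurable_messageTime (β : ℝ≥0) (hω : Measurable ω) (hk : Measurable k) :
    Measurable fun a => messageTime β (ω a) (k a) :=
  measurable_comp_index (f := fun k a => messageTime β (ω a) k)
    (fun k => (Finset.measurable_sum _ fun j _ => by fun_prop).coe_nnreal_ennreal.div_const _) hk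

@[fun_prop]
theorem measurable_jobSize (hω : Measurable ω) (hk : Measurable k) :
    Measurable fun a => jobSize (ω a) (k a) :=
  measurable_apply_index (q := fun a => (ω a).2.2.1) (by fun_prop) hk

@[fun_prop]
theorem measurable_unif (i : Fin 8) (hω : Measurable ω) (hk : Measurable k) :
    Measurable fun a => unif (ω a) i (k a) :=
  measurable_apply_index (q := fun a => (ω a).2.2.2 i) (by fun_prop) hk

end Sample

/-- The σ-algebra of `Config`, induced from the product of its fields. -/
instance instMeasurableSpaceConfig : MeasurableSpace (Config n c) :=
  MeasurableSpace.comap (fun C => (C.time, C.state, C.arr, C.spon, C.dep, C.msgs)) inferInstance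

section Fields

variable {C : α → Config n c}

theorem measurable_config_iff :
    Measurable C ↔ (Measurable fun a => (C a).time) ∧ (Measurable fun a => (C a).state) ∧
      (Measurable fun a => (C a).arr) ∧ (Measurable fun a => (C a).spon) ∧
      (Measurable fun a => (C a).dep) ∧ (Measurable fun a => (C a).msgs) := by
  rw [measurable_comap_iff]
  exact ⟨fun h => ⟨h.fst, h.snd.fst, h.snd.snd.fst, h.snd.snd.snd.fst, h.snd.snd.snd.snd.fst,
      h.snd.snd.snd.snd.snd⟩,
    fun ⟨ht, hs, ha, hm, hd, hc⟩ =>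
      ht.prodMk (hs.prodMk (ha.prodMk (hm.prodMk (hd.prodMk hc))))⟩

@[fun_prop]
theorem measurable_time (hC : Measurable C) : Measurable fun a => (C a).time :=
  (measurable_config_iff.1 hC).1

@[fun_prop]
theorem measurable_state (hC : Measurable C) : Measurable fun a => (C a).state :=
  (measurable_config_iff.1 hC).2.1

@[fun_prop]
theorem measurable_arr (hC : Measurable C) : Measurable fun a => (C a).arr :=
  (measurable_config_iff.1 hC).2.2.1

@[fun_prop]
theorem measurable_spon (hC : Measurable C) : Measurable fun a => (C a).spon :=
  (measurable_config_iff.1 hC).2.2.2.1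

@[fun_prop]
theorem measurable_dep (hC : Measurable C) : Measurable fun a => (C a).dep :=
  (measurable_config_iff.1 hC).2.2.2.2.1

@[fun_prop]
theorem measurable_msgs (hC : Measurable C) : Measurable fun a => (C a).msgs :=
  (measurable_config_iff.1 hC).2.2.2.2.2

end Fields

@[fun_prop]
theorem measurable_flow (μ : Fin n → ℝ≥0) {d : α → ℝ≥0} {s : α → State n c} (hd : Measurable d)
    (hs : Measurable s) : Measurable fun a => flow μ (d a) (s a) := by
  unfold flow
  fun_prop

variable (P : Policy n c) (μ : Fin n → ℝ≥0) (z : ℝ≥0)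

section Events

variable {ω : α → Sample} {t : α → ℝ≥0} {C : α → Config n c}

theorem measurable_onArrival (hω : Measurable ω) (ht : Measurable t) (hC : Measurable C) :
    Measurable fun a => onArrival P μ (ω a) (t a) (C a) := by
  have harr := measurable_arr hC
  have hs : Measurable fun a => flow μ (t a - (C a).time) (C a).state := by fun_prop
  have hw : Measurable fun a => jobSize (ω a) (C a).arr := by fun_prop
  have hS := P.measurable_f₁.comp (hs.snd.fst.prodMk
    (hw.prodMk (measurable_unif 0 hω harr)))
  have hr := measurable_report μ hs.fst hS
  have hD := P.measurable_f₂.comp (hs.snd.fst.prodMk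
    (hw.prodMk (hr.prodMk (measurable_unif 1 hω harr))))
  have hM := P.measurable_f₃.comp (hs.snd.fst.prodMk
    (hw.prodMk (hr.prodMk (hD.prodMk (measurable_unif 2 hω harr)))))
  have hcard := (measurable_of_countable fun S : Finset (Fin n) => 2 * S.card).comp hS
  have hspon := measurable_spon hC
  have hdep := measurable_dep hC
  have hmsgs := measurable_msgs hC
  refine measurable_config_iff.2 ⟨ht, ?_, harr.add_const 1, hspon, hdep, hmsgs.add hcard⟩
  exact (measurable_update_index hs.fst hD (measurable_append_singleton hw
    (measurable_apply_index hs.fst hD))).prodMk (hM.prodMk measurable_const)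

theorem measurable_onMessage (hω : Measurable ω) (ht : Measurable t) (hC : Measurable C) :
    Measurable fun a => onMessage P μ (ω a) (t a) (C a) := by
  have hs : Measurable fun a => flow μ (t a - (C a).time) (C a).state := by fun_prop
  have harr := measurable_arr hC
  have hspon := measurable_spon hC
  have hdep := measurable_dep hC
  have hmsgs := measurable_msgs hC
  have hg := P.measurable_g₁.comp (hs.fst.prodMk
    ((measurable_const (a := μ)).prodMk (measurable_unif 3 hω hspon)))
  refine measurable_of_index hg fun o => ?_
  cases o with
  | none =>
    refine ⟨fun a => { C a with
      time := t a, state := flow μ (t a - (C a).time) (C a).state, spon := (C a).spon + 1 },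
      measurable_config_iff.2 ⟨ht, hs, harr, hspon.add_const 1, hdep, hmsgs⟩, fun a ha => ?_⟩
    simp only [Function.comp_apply] at ha
    simp only [onMessage, ha]
  | some i =>
    have hqi : Measurable fun a => (flow μ (t a - (C a).time) (C a).state).1 i := by fun_prop
    have hS := P.measurable_g₂.comp (hs.snd.fst.prodMk ((measurable_const (a := i)).prodMk
      (hqi.prodMk ((measurable_const (a := μ i)).prodMk (measurable_unif 4 hω hspon)))))
    have hM := P.measurable_g₃.comp (hs.snd.fst.prodMk ((measurable_const (a := i)).prodMk
      (hqi.prodMk ((measurable_const (a := μ i)).prodMk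
        ((measurable_report μ hs.fst hS).prodMk (measurable_unif 5 hω hspon))))))
    have hcard := (measurable_of_countable fun S : Finset (Fin n) => 1 + 2 * S.card).comp hS
    refine ⟨fun a => ⟨t a, (_, _, _), (C a).arr, (C a).spon + 1, (C a).dep, (C a).msgs + _⟩,
      measurable_config_iff.2 ⟨ht, hs.fst.prodMk (hM.prodMk hs.snd.snd), harr,
        hspon.add_const 1, hdep, hmsgs.add hcard⟩, fun a ha => ?_⟩
    simp only [Function.comp_apply] at ha
    simp only [onMessage, ha, Function.comp_apply]

theorem measurable_onDeparture (i : Fin n) (hω : Measurable ω) (ht : Measurable t)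
    (hC : Measurable C) : Measurable fun a => onDeparture P μ (ω a) i (t a) (C a) := by
  have hs : Measurable fun a => flow μ (t a - (C a).time) (C a).state := by fun_prop
  have harr := measurable_arr hC
  have hspon := measurable_spon hC
  have hdep := measurable_dep hC
  have hmsgs := measurable_msgs hC
  have hq := measurable_update_index hs.fst (measurable_const (a := i))
    (measurable_tail ((measurable_pi_apply i).comp hs.fst))
  have hqi := (measurable_pi_apply i).comp hq
  have hb := P.measurable_h₁.comp (hqi.prodMk
    ((measurable_const (a := μ i)).prodMk (measurable_unif 6 hω hdep)))
  have hM := P.measurable_h₂.comp (hs.snd.fst.prodMk ((measurable_const (a := i)).prodMk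
    (hqi.prodMk ((measurable_const (a := μ i)).prodMk (measurable_unif 7 hω hdep)))))
  have hsent := measurableSet_eq_fun hb (measurable_const (a := true))
  exact measurable_config_iff.2 ⟨ht,
    hq.prodMk ((Measurable.ite hsent hM hs.snd.fst).prodMk hs.snd.snd), harr, hspon,
    hdep.add_const 1, hmsgs.add (Measurable.ite hsent measurable_const measurable_const)⟩

/-- The time of the next service completion at server `i` (`∞` if it is idle). -/
noncomputable def completionTime (C : Config n c) (i : Fin n) : ℝ≥0∞ :=
  C.time + completionDelay (μ i) (C.state.1 i)

/-- The event following the situation `C` is an arrival. -/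
def ArrivalNext (ω : Sample) (C : Config n c) : Prop :=
  (arrivalTime z ω C.arr : ℝ≥0∞) ≤ messageTime P.β ω C.spon ∧
    ∀ i, (arrivalTime z ω C.arr : ℝ≥0∞) ≤ completionTime μ C i

theorem measurable_completionTime (hC : Measurable C) (i : Fin n) :
    Measurable fun a => completionTime μ (C a) i := by
  unfold completionTime
  fun_prop

theorem measurableSet_forall_le {ι : Type*} [Countable ι] {f : α → ℝ≥0∞} {g : ι → α → ℝ≥0∞}
    (hf : Measurable f) (hg : ∀ i, Measurable (g i)) : MeasurableSet {a | ∀ i, f a ≤ g i a} := by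
  rw [Set.ofPred_forall]
  exact MeasurableSet.iInter fun i => measurableSet_le hf (hg i)

theorem measurableSet_arrivalNext (hω : Measurable ω) (hC : Measurable C) :
    MeasurableSet {a | ArrivalNext P μ z (ω a) (C a)} :=
  have harrival : Measurable fun a => (arrivalTime z (ω a) (C a).arr : ℝ≥0∞) := by fun_prop
  have hmessage : Measurable fun a => messageTime P.β (ω a) (C a).spon := by fun_prop
  (measurableSet_le harrival hmessage).inter
    (measurableSet_forall_le harrival (measurable_completionTime μ hC))

open Classical in
theorem step_eq (ω : Sample) (C : Config n c) : step P μ z ω C =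
    if ArrivalNext P μ z ω C then onArrival P μ ω (arrivalTime z ω C.arr) C
    else if ∀ i, messageTime P.β ω C.spon ≤ completionTime μ C i then
      onMessage P μ ω (messageTime P.β ω C.spon).toNNReal C
    else
      match (List.finRange n).find?
        (fun i => decide (∀ j, completionTime μ C i ≤ completionTime μ C j)) with
      | none => C
      | some i => onDeparture P μ ω i (completionTime μ C i).toNNReal C := by
  unfold step ArrivalNext completionTime
  congr!

theorem measurable_step (hω : Measurable ω) (hC : Measurable C) :
    Measurable fun a => step P μ z (ω a) (C a) := by
  have hmessage : Measurable fun a => messageTime P.β (ω a) (C a).spon := by fun_prop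
  have hcompletion := measurable_completionTime μ hC
  have hfirst : Measurable fun a => (List.finRange n).find?
      fun i => decide (∀ j, completionTime μ (C a) i ≤ completionTime μ (C a) j) := by
    refine measurable_find? (fun i => measurable_to_bool ?_) _
    simpa [Set.preimage] using measurableSet_forall_le (hcompletion i) hcompletion
  simp only [step_eq]
  refine Measurable.ite (measurableSet_arrivalNext P μ z hω hC)
    (measurable_onArrival P μ hω (by fun_prop) hC)
    (Measurable.ite (measurableSet_forall_le hmessage hcompletion)
      (measurable_onMessage P μ hω hmessage.ennreal_toNNReal hC)
      (measurable_of_index hfirst fun o => ?_))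
  cases o with
  | none => exact ⟨C, hC, fun a ha => by simp only [ha]⟩
  | some i =>
    exact ⟨_, measurable_onDeparture P μ i hω (hcompletion i).ennreal_toNNReal hC,
      fun a ha => by simp only [ha]⟩

end Events

@[fun_prop]
theorem measurable_configAfter (x : State n c) (k : ℕ) :
    Measurable fun ω => configAfter P μ x ω k := by
  induction k with
  | zero => exact measurable_const
  | succ k ih =>
    simp only [configAfter, Function.iterate_succ_apply'] at ih ⊢
    exact measurable_step P μ x.2.2 measurable_id ih

end

/-! ### Invariants of the sample paths -/

section

variable {n c : ℕ}

theorem arrivalTime_mono (z : ℝ≥0) (ω : Sample) : Monotone (arrivalTime z ω) := fun _ _ h =>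
  tsub_le_tsub_right (Finset.sum_le_sum_of_subset (Finset.range_mono (by lia))) z

theorem messageTime_mono (β : ℝ≥0) (ω : Sample) : Monotone (messageTime β ω) := fun _ _ h =>
  ENNReal.div_le_div_right (ENNReal.coe_le_coe.2
    (Finset.sum_le_sum_of_subset (Finset.range_mono (by lia)))) _

theorem sum_le_sum_serve_add (x : ℝ≥0) (q : Queue) : q.sum ≤ (serve x q).sum + x := by
  cases q with
  | nil => simp [serve]
  | cons w l =>
    simp only [serve, List.sum_cons]
    calc w + l.sum ≤ (w - x + x) + l.sum := by gcongr; exact le_tsub_add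
      _ = (w - x) + l.sum + x := by ring

theorem length_serve (x : ℝ≥0) (q : Queue) : (serve x q).length = q.length := by
  cases q <;> rfl

theorem sum_apply_update {ι β M : Type*} [DecidableEq ι] [AddCommMonoid M] (N : Finset ι)
    (f : β → M) (q : ι → β) {i : ι} {x : β} {y : M} (h : f x = f (q i) + y) :
    ∑ j ∈ N, f (Function.update q i x j) = ∑ j ∈ N, f (q j) + if i ∈ N then y else 0 := by
  have hpointwise : ∀ j, f (Function.update q i x j) = f (q j) + if i = j then y else 0 := by
    intro j
    rcases eq_or_ne i j with rfl | hij
    · simp [h]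
    · simp [hij, Function.update_of_ne hij.symm]
  simp only [hpointwise, Finset.sum_add_distrib, Finset.sum_ite_eq]

/-- Number of jobs present in the state `s`. -/
def jobCount (s : State n c) : ℕ := ∑ i, (s.1 i).length

/-- Remaining workload of the servers in `N`. -/
noncomputable def workloadOn (N : Finset (Fin n)) (s : State n c) : ℝ≥0 := ∑ i ∈ N, (s.1 i).sum

theorem jobCount_flow (μ : Fin n → ℝ≥0) (d : ℝ≥0) (s : State n c) :
    jobCount (flow μ d s) = jobCount s := by
  simp only [jobCount, flow, length_serve]

variable {P : Policy n c} {μ : Fin n → ℝ≥0} {x : State n c} {z : ℝ≥0} {ω : Sample}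
  {C C' : Config n c}

variable (P) in
/-- Servers queried at an arrival that finds the state `s`. -/
def queried (s : State n c) (w : ℝ≥0) (u : unitInterval) : Finset (Fin n) := P.f₁ s.2.1 w u

variable (P μ) in
/-- Destination of a job that finds the state `s`. -/
def destination (s : State n c) (w : ℝ≥0) (u v : unitInterval) : Fin n :=
  P.f₂ s.2.1 w (report s.1 μ (queried P s w u)) v

theorem le_workloadOn_flow_add {N : Finset (Fin n)} {s : State n c} {W t₀ t : ℝ≥0}
    (hW : W ≤ workloadOn N s + (∑ i ∈ N, μ i) * t₀) (ht : t₀ ≤ t) :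
    W ≤ workloadOn N (flow μ (t - t₀) s) + (∑ i ∈ N, μ i) * t := by
  have hflow : workloadOn N s ≤
      workloadOn N (flow μ (t - t₀) s) + (∑ i ∈ N, μ i) * (t - t₀) := by
    rw [workloadOn, workloadOn, Finset.sum_mul, ← Finset.sum_add_distrib]
    exact Finset.sum_le_sum fun i _ => sum_le_sum_serve_add _ _
  calc W ≤ workloadOn N s + (∑ i ∈ N, μ i) * t₀ := hW
    _ ≤ workloadOn N (flow μ (t - t₀) s) + (∑ i ∈ N, μ i) * (t - t₀) +
        (∑ i ∈ N, μ i) * t₀ := by gcongr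
    _ = workloadOn N (flow μ (t - t₀) s) + (∑ i ∈ N, μ i) * t := by
      rw [add_assoc, ← mul_add, tsub_add_cancel_of_le ht]

theorem jobCount_onArrival (t : ℝ≥0) :
    jobCount (onArrival P μ ω t C).state = jobCount C.state + 1 := by
  rw [jobCount, onArrival, sum_apply_update Finset.univ List.length _ List.length_append,
    ← jobCount_flow μ (t - C.time)]
  simp [jobCount]

theorem workloadOn_onArrival (N : Finset (Fin n)) (t : ℝ≥0) :
    workloadOn N (onArrival P μ ω t C).state = workloadOn N (flow μ (t - C.time) C.state) +
      if destination P μ (flow μ (t - C.time) C.state) (jobSize ω C.arr) (unif ω 0 C.arr)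
        (unif ω 1 C.arr) ∈ N then jobSize ω C.arr else 0 :=
  sum_apply_update N List.sum _ (by rw [List.sum_append, List.sum_singleton])

section OnMessage

variable (P μ ω C) (t : ℝ≥0)

@[simp]
theorem onMessage_time : (onMessage P μ ω t C).time = t := by
  unfold onMessage; dsimp only; split <;> rfl

@[simp]
theorem onMessage_arr : (onMessage P μ ω t C).arr = C.arr := by
  unfold onMessage; dsimp only; split <;> rfl

@[simp]
theorem onMessage_spon : (onMessage P μ ω t C).spon = C.spon + 1 := by
  unfold onMessage; dsimp only; split <;> rfl

@[simp]
theorem onMessage_dep : (onMessage P μ ω t C).dep = C.dep := by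
  unfold onMessage; dsimp only; split <;> rfl

theorem onMessage_queues :
    (onMessage P μ ω t C).state.1 = (flow μ (t - C.time) C.state).1 := by
  unfold onMessage; dsimp only; split <;> rfl

theorem msgs_le_onMessage : C.msgs ≤ (onMessage P μ ω t C).msgs := by
  unfold onMessage; dsimp only; split <;> simp

theorem workloadOn_onMessage (N : Finset (Fin n)) : workloadOn N (onMessage P μ ω t C).state =
    workloadOn N (flow μ (t - C.time) C.state) := by
  simp only [workloadOn, onMessage_queues]

theorem jobCount_onMessage : jobCount (onMessage P μ ω t C).state = jobCount C.state := by
  rw [← jobCount_flow μ (t - C.time) C.state]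
  simp only [jobCount, onMessage_queues]

end OnMessage

section OnDeparture

variable {i : Fin n} {t : ℝ≥0}

theorem exists_cons_of_completionTime_eq (h : completionTime μ C i = t) :
    ∃ w l, C.state.1 i = w :: l ∧ (w : ℝ≥0∞) / μ i = (t - C.time : ℝ≥0) := by
  cases hq : C.state.1 i with
  | nil => simp [completionTime, hq, completionDelay] at h
  | cons w l =>
    refine ⟨w, l, rfl, ?_⟩
    rw [completionTime, hq, completionDelay] at h
    rw [ENNReal.coe_sub, ← h, ENNReal.add_sub_cancel_left ENNReal.coe_ne_top]

theorem time_le_of_completionTime_eq (h : completionTime μ C i = t) : C.time ≤ t :=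
  ENNReal.coe_le_coe.1 (h ▸ le_self_add)

theorem jobCount_onDeparture (h : completionTime μ C i = t) :
    jobCount (onDeparture P μ ω i t C).state + 1 = jobCount C.state := by
  obtain ⟨w, l, hq, -⟩ := exists_cons_of_completionTime_eq h
  have hqueue : (flow μ (t - C.time) C.state).1 i = (w - μ i * (t - C.time)) :: l := by
    simp only [flow, hq, serve]
  have hsum := sum_apply_update Finset.univ List.length (onDeparture P μ ω i t C).state.1
    (i := i) (x := (flow μ (t - C.time) C.state).1 i) (y := 1)
    (by simp [onDeparture, hqueue])
  rw [← jobCount_flow μ (t - C.time) C.state]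
  simpa [onDeparture, jobCount] using hsum.symm

theorem workloadOn_onDeparture (hμ : 0 < μ i) (h : completionTime μ C i = t)
    (N : Finset (Fin n)) : workloadOn N (onDeparture P μ ω i t C).state =
      workloadOn N (flow μ (t - C.time) C.state) := by
  obtain ⟨w, l, hq, hw⟩ := exists_cons_of_completionTime_eq h
  have hserved : w = μ i * (t - C.time) := by
    rw [← ENNReal.coe_div hμ.ne', ENNReal.coe_inj, div_eq_iff hμ.ne'] at hw
    rw [hw, mul_comm]
  have htail : ((flow μ (t - C.time) C.state).1 i).tail.sum =
      ((flow μ (t - C.time) C.state).1 i).sum + 0 := by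
    simp [flow, hq, serve, hserved]
  simp [workloadOn, onDeparture, sum_apply_update N List.sum _ htail]

end OnDeparture

section NextEvent

variable (P μ z ω) in
/-- `NextEvent P μ z ω C C'`: the situation `C'` results from `C` by an event that is due no later
than the next arrival. -/
inductive NextEvent (C : Config n c) : Config n c → Prop
  | arrival : ArrivalNext P μ z ω C → NextEvent C (onArrival P μ ω (arrivalTime z ω C.arr) C)
  | message {t : ℝ≥0} : messageTime P.β ω C.spon = t → t ≤ arrivalTime z ω C.arr →
      NextEvent C (onMessage P μ ω t C)
  | departure {i : Fin n} {t : ℝ≥0} : completionTime μ C i = t → t ≤ arrivalTime z ω C.arr →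
      (t : ℝ≥0∞) ≤ messageTime P.β ω C.spon → NextEvent C (onDeparture P μ ω i t C)

theorem step_of_arrivalNext (h : ArrivalNext P μ z ω C) :
    step P μ z ω C = onArrival P μ ω (arrivalTime z ω C.arr) C := by
  rw [step_eq, if_pos h]

variable (P μ z ω C) in
theorem nextEvent_step : NextEvent P μ z ω C (step P μ z ω C) := by
  classical
  by_cases harrival : ArrivalNext P μ z ω C
  · exact step_of_arrivalNext harrival ▸ .arrival harrival
  rw [step_eq, if_neg harrival]
  split_ifs with hmessage
  · have hle : messageTime P.β ω C.spon ≤ arrivalTime z ω C.arr := by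
      by_contra! hlt
      exact harrival ⟨hlt.le, fun i => hlt.le.trans (hmessage i)⟩
    lift messageTime P.β ω C.spon to ℝ≥0 using ne_top_of_le_ne_top ENNReal.coe_ne_top hle
      with t ht
    exact .message ht.symm (ENNReal.coe_le_coe.1 hle)
  push Not at hmessage
  obtain ⟨i₀, hi₀⟩ := hmessage
  obtain ⟨i₁, -, hmin⟩ := Finset.exists_min_image Finset.univ (completionTime μ C)
    ⟨i₀, Finset.mem_univ _⟩
  cases hfind : (List.finRange n).find?
      (fun i => decide (∀ j, completionTime μ C i ≤ completionTime μ C j)) with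
  | none =>
    rw [List.find?_eq_none] at hfind
    exact absurd (decide_eq_true fun j => hmin j (Finset.mem_univ _))
      (hfind i₁ (List.mem_finRange i₁))
  | some i =>
    have hi : ∀ j, completionTime μ C i ≤ completionTime μ C j := by
      simpa using List.find?_some hfind
    have hle : completionTime μ C i ≤ arrivalTime z ω C.arr := by
      by_contra! hlt
      exact harrival ⟨hlt.le.trans ((hi i₀).trans hi₀.le), fun j => hlt.le.trans (hi j)⟩
    have htop := ne_top_of_le_ne_top ENNReal.coe_ne_top hle
    refine .departure (ENNReal.coe_toNNReal htop).symm
      (ENNReal.toNNReal_mono ENNReal.coe_ne_top hle) ?_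
    rw [ENNReal.coe_toNNReal htop]
    exact (hi i₀).trans hi₀.le

theorem NextEvent.time_le_arrivalTime (h : NextEvent P μ z ω C C') :
    C'.time ≤ arrivalTime z ω C.arr := by
  cases h with
  | arrival => exact le_rfl
  | message _ hle => rwa [onMessage_time]
  | departure _ hle _ => exact hle

theorem NextEvent.arr_le (h : NextEvent P μ z ω C C') : C.arr ≤ C'.arr := by
  cases h with
  | arrival => exact Nat.le_succ _
  | message => rw [onMessage_arr]
  | departure => exact le_rfl

theorem NextEvent.eventCount_eq (h : NextEvent P μ z ω C C') :
    C'.arr + C'.spon + C'.dep = C.arr + C.spon + C.dep + 1 := by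
  cases h with
  | arrival => simp only [onArrival]; lia
  | message => simp only [onMessage_arr, onMessage_spon, onMessage_dep]; lia
  | departure => simp only [onDeparture]; lia

theorem NextEvent.jobCount_balance (h : NextEvent P μ z ω C C') :
    C'.dep + jobCount C'.state + C.arr = C.dep + jobCount C.state + C'.arr := by
  cases h with
  | arrival => rw [jobCount_onArrival]; simp only [onArrival]; lia
  | message => rw [jobCount_onMessage, onMessage_dep, onMessage_arr]
  | departure ht => rw [← jobCount_onDeparture (P := P) (ω := ω) ht]; simp only [onDeparture]; lia

variable (P z ω) in
/-- The clock of the situation `C` separates the past arrivals and spontaneous messages from the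
future ones. -/
structure ClockConsistent (C : Config n c) : Prop where
  time_le_arrivalTime : C.time ≤ arrivalTime z ω C.arr
  time_le_messageTime : (C.time : ℝ≥0∞) ≤ messageTime P.β ω C.spon
  arrivalTime_le : ∀ j < C.arr, arrivalTime z ω j ≤ C.time
  messageTime_le : ∀ j < C.spon, messageTime P.β ω j ≤ C.time

theorem NextEvent.time_le (h : NextEvent P μ z ω C C') (hC : ClockConsistent P z ω C) :
    C.time ≤ C'.time := by
  cases h with
  | arrival => exact hC.time_le_arrivalTime
  | message ht => rw [onMessage_time]; exact ENNReal.coe_le_coe.1 (ht ▸ hC.time_le_messageTime)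
  | departure ht => exact time_le_of_completionTime_eq ht

theorem NextEvent.clockConsistent (h : NextEvent P μ z ω C C') (hC : ClockConsistent P z ω C) :
    ClockConsistent P z ω C' := by
  have hle := h.time_le hC
  have harrival : ∀ j < C.arr, arrivalTime z ω j ≤ C'.time :=
    fun j hj => (hC.arrivalTime_le j hj).trans hle
  have hmessage : ∀ j < C.spon, messageTime P.β ω j ≤ C'.time :=
    fun j hj => (hC.messageTime_le j hj).trans (ENNReal.coe_le_coe.2 hle)
  cases h with
  | arrival hnext =>
    exact ⟨arrivalTime_mono z ω (Nat.le_succ _), hnext.1,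
      fun j hj => arrivalTime_mono z ω (Nat.le_of_lt_succ hj), hmessage⟩
  | message ht hta =>
    constructor <;> simp only [onMessage_time, onMessage_arr, onMessage_spon, ← ht] at *
    · exact hta
    · exact messageTime_mono P.β ω (Nat.le_succ _)
    · exact harrival
    · exact fun j hj => messageTime_mono P.β ω (Nat.le_of_lt_succ hj)
  | departure ht hta htm => exact ⟨hta, htm, harrival, hmessage⟩

end NextEvent

section Path

variable (P μ x ω)

theorem configAfter_succ (k : ℕ) :
    configAfter P μ x ω (k + 1) = step P μ x.2.2 ω (configAfter P μ x ω k) :=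
  Function.iterate_succ_apply' _ _ _

theorem nextEvent_configAfter (k : ℕ) :
    NextEvent P μ x.2.2 ω (configAfter P μ x ω k) (configAfter P μ x ω (k + 1)) :=
  configAfter_succ P μ x ω k ▸ nextEvent_step P μ x.2.2 ω _

theorem arr_mono : Monotone fun k => (configAfter P μ x ω k).arr :=
  monotone_nat_of_le_succ fun k => (nextEvent_configAfter P μ x ω k).arr_le

theorem clockConsistent_configAfter (k : ℕ) :
    ClockConsistent P x.2.2 ω (configAfter P μ x ω k) := by
  induction k with
  | zero => constructor <;> simp [configAfter]
  | succ k ih => exact (nextEvent_configAfter P μ x ω k).clockConsistent ih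

theorem le_of_arr_le_of_spon_le {k a m : ℕ} (ha : (configAfter P μ x ω k).arr ≤ a)
    (hm : (configAfter P μ x ω k).spon ≤ m) : k ≤ 2 * a + m + jobCount x := by
  have hinv : ∀ k, k = (configAfter P μ x ω k).arr + (configAfter P μ x ω k).spon +
        (configAfter P μ x ω k).dep ∧
      (configAfter P μ x ω k).dep + jobCount (configAfter P μ x ω k).state =
        jobCount x + (configAfter P μ x ω k).arr := by
    intro k
    induction k with
    | zero => simp [configAfter]
    | succ k ih =>
      have hcount := (nextEvent_configAfter P μ x ω k).eventCount_eq
      have hjobs := (nextEvent_configAfter P μ x ω k).jobCount_balance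
      lia
  have := hinv k
  lia

/-- The possible numbers of events before arrival number `j`; there is at most one of them. -/
def preIndices (j : ℕ) : Set ℕ :=
  {k | (configAfter P μ x ω k).arr = j ∧ ArrivalNext P μ x.2.2 ω (configAfter P μ x ω k)}

/-- Number of events before arrival number `j` (`0` if that arrival never occurs). -/
noncomputable def preIndex (j : ℕ) : ℕ := sInf (preIndices P μ x ω j)

/-- State just before arrival number `j`. -/
noncomputable def preState (j : ℕ) : State n c :=
  flow μ (arrivalTime x.2.2 ω j - (configAfter P μ x ω (preIndex P μ x ω j)).time)
    (configAfter P μ x ω (preIndex P μ x ω j)).state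

/-- Servers queried at arrival number `j`. -/
noncomputable def queriedAt (j : ℕ) : Finset (Fin n) :=
  queried P (preState P μ x ω j) (jobSize ω j) (unif ω 0 j)

/-- Destination of job number `j`. -/
noncomputable def destinationAt (j : ℕ) : Fin n :=
  destination P μ (preState P μ x ω j) (jobSize ω j) (unif ω 0 j) (unif ω 1 j)

/-- Total size of the first `k` jobs that are sent to the servers in `N`. -/
noncomputable def workSent (N : Finset (Fin n)) (k : ℕ) : ℝ≥0 :=
  ∑ j ∈ Finset.range k, if destinationAt P μ x ω j ∈ N then jobSize ω j else 0

variable {P μ x ω} {k : ℕ}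

theorem preIndex_arr (h : ArrivalNext P μ x.2.2 ω (configAfter P μ x ω k)) :
    preIndex P μ x ω (configAfter P μ x ω k).arr = k := by
  refine le_antisymm (Nat.sInf_le ⟨rfl, h⟩) (le_csInf ⟨k, rfl, h⟩ ?_)
  rintro l ⟨hl, hnext⟩
  by_contra! hlk
  have hsucc : (configAfter P μ x ω (l + 1)).arr = (configAfter P μ x ω l).arr + 1 := by
    rw [configAfter_succ, step_of_arrivalNext hnext, onArrival]
  have hmono : (configAfter P μ x ω (l + 1)).arr ≤ (configAfter P μ x ω k).arr :=
    arr_mono P μ x ω (Nat.succ_le_of_lt hlk)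
  lia

theorem preState_arr (h : ArrivalNext P μ x.2.2 ω (configAfter P μ x ω k)) :
    preState P μ x ω (configAfter P μ x ω k).arr =
      flow μ (arrivalTime x.2.2 ω (configAfter P μ x ω k).arr - (configAfter P μ x ω k).time)
        (configAfter P μ x ω k).state := by
  rw [preState, preIndex_arr h]

theorem two_mul_sum_card_queriedAt_le_msgs (k : ℕ) :
    2 * ∑ j ∈ Finset.range (configAfter P μ x ω k).arr, (queriedAt P μ x ω j).card ≤
      (configAfter P μ x ω k).msgs := by
  induction k with
  | zero => simp [configAfter]
  | succ k ih =>
    have hevent := nextEvent_configAfter P μ x ω k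
    generalize configAfter P μ x ω (k + 1) = C' at hevent ⊢
    cases hevent with
    | arrival hnext =>
      simp only [onArrival, Finset.sum_range_succ, queriedAt, preState_arr hnext, queried]
      simp only [queriedAt, queried] at ih
      lia
    | message => exact (onMessage_arr P μ ω _ _ ▸ ih).trans (msgs_le_onMessage P μ ω _ _)
    | departure => exact ih.trans (Nat.le_add_right _ _)

theorem workSent_le (hμ : ∀ i, 0 < μ i) (N : Finset (Fin n)) (k : ℕ) :
    workSent P μ x ω N (configAfter P μ x ω k).arr ≤
      workloadOn N (configAfter P μ x ω k).state +
        (∑ i ∈ N, μ i) * (configAfter P μ x ω k).time := by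
  induction k with
  | zero => simp [configAfter, workSent]
  | succ k ih =>
    have hevent := nextEvent_configAfter P μ x ω k
    have hflow := le_workloadOn_flow_add ih
      (hevent.time_le (clockConsistent_configAfter P μ x ω k))
    generalize configAfter P μ x ω (k + 1) = C' at hevent hflow ⊢
    cases hevent with
    | arrival hnext =>
      rw [workloadOn_onArrival, add_right_comm, ← preState_arr hnext]
      refine (Finset.sum_range_succ _ _).trans_le (add_le_add_left ?_ _)
      rwa [preState_arr hnext]
    | message =>
      rw [onMessage_time] at hflow
      rwa [workloadOn_onMessage, onMessage_arr, onMessage_time]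
    | departure ht => rwa [workloadOn_onDeparture (hμ _) ht]

end Path

section NonExplosive

/-- Neither arrivals nor spontaneous messages accumulate. -/
structure NonExplosive (β z : ℝ≥0) (ω : Sample) : Prop where
  arrival : ∀ t : ℝ≥0, ∃ k, t < arrivalTime z ω k
  message : ∀ t : ℝ≥0, ∃ k, (t : ℝ≥0∞) < messageTime β ω k

theorem bddAbove_setOf_time_le (hω : NonExplosive P.β x.2.2 ω) (t : ℝ≥0) :
    BddAbove {k : ℕ | (configAfter P μ x ω k).time ≤ t} := by
  obtain ⟨a, ha⟩ := hω.arrival t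
  obtain ⟨m, hm⟩ := hω.message t
  refine ⟨2 * a + m + jobCount x, fun k (hk : (configAfter P μ x ω k).time ≤ t) => ?_⟩
  have hclock := clockConsistent_configAfter P μ x ω k
  refine le_of_arr_le_of_spon_le P μ x ω ?_ ?_ <;> by_contra! hlt
  · exact ha.not_ge ((hclock.arrivalTime_le a hlt).trans hk)
  · exact hm.not_ge ((hclock.messageTime_le m hlt).trans (ENNReal.coe_le_coe.2 hk))

theorem time_configAt_le (hω : NonExplosive P.β x.2.2 ω) (t : ℝ≥0) :
    (configAt P μ x t ω).time ≤ t :=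
  Nat.sSup_mem (s := {k : ℕ | (configAfter P μ x ω k).time ≤ t})
    ⟨0, show (0 : ℝ≥0) ≤ t from zero_le⟩ (bddAbove_setOf_time_le hω t)

theorem lt_arrivalTime_configAt (hω : NonExplosive P.β x.2.2 ω) (t : ℝ≥0) :
    t < arrivalTime x.2.2 ω (configAt P μ x t ω).arr := by
  refine lt_of_lt_of_le ?_
    (nextEvent_configAfter P μ x ω (eventCount P μ x t ω)).time_le_arrivalTime
  by_contra! hle
  exact absurd (le_csSup (bddAbove_setOf_time_le hω t) hle) (Nat.not_succ_le_self _)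

theorem workSent_configAt_le (hμ : ∀ i, 0 < μ i) (hω : NonExplosive P.β x.2.2 ω)
    (N : Finset (Fin n)) (t : ℝ≥0) :
    workSent P μ x ω N (configAt P μ x t ω).arr ≤
      totalWorkload P μ x t ω + (∑ i ∈ N, μ i) * t := by
  refine (le_workloadOn_flow_add (workSent_le hμ N _) (time_configAt_le hω t)).trans ?_
  gcongr
  exact Finset.sum_le_sum_of_subset (f := fun i => ((process P μ x t ω).1 i).sum)
    (Finset.subset_univ N)

end NonExplosive

end

/-! ### Resampling the variables of one job -/

section MeasurePreserving

variable {X Y Z Z' : Type*} [MeasurableSpace X] [MeasurableSpace Y] [MeasurableSpace Z]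
  [MeasurableSpace Z'] {μ : Measure X} {ν : Measure Y} {ρ : Measure Z} {ρ' : Measure Z'}

theorem measurePreserving_prodAssoc [SFinite μ] [SFinite ν] [SFinite ρ] :
    MeasurePreserving (MeasurableEquiv.prodAssoc : (X × Y) × Z ≃ᵐ X × Y × Z)
      ((μ.prod ν).prod ρ) (μ.prod (ν.prod ρ)) :=
  ⟨MeasurableEquiv.prodAssoc.measurable, Measure.prodAssoc_prod⟩

theorem measurePreserving_resample_snd [SFinite μ] [SFinite ν] [SFinite ρ] {ψ : Y × Z → Y}
    (h : MeasurePreserving ψ (ν.prod ρ) ν) :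
    MeasurePreserving (fun p : (X × Y) × Z => (p.1.1, ψ (p.1.2, p.2))) ((μ.prod ν).prod ρ)
      (μ.prod ν) :=
  ((MeasurePreserving.id μ).prod h).comp measurePreserving_prodAssoc

theorem measurePreserving_resample_fst [SFinite μ] [SFinite ν] [SFinite ρ] {ψ : X × Z → X}
    (h : MeasurePreserving ψ (μ.prod ρ) μ) :
    MeasurePreserving (fun p : (X × Y) × Z => (ψ (p.1.1, p.2), p.1.2)) ((μ.prod ν).prod ρ)
      (μ.prod ν) :=
  have hswap : MeasurePreserving (Prod.swap : Y × X → X × Y) (ν.prod μ) (μ.prod ν) :=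
    Measure.measurePreserving_swap
  hswap.comp ((measurePreserving_resample_snd h).comp
    (Measure.measurePreserving_swap.prod (MeasurePreserving.id ρ)))

theorem measurePreserving_resample_comp [SFinite ν] [SFinite ρ] [SFinite ρ'] {ψ : Y × Z → Y}
    {ψ' : Y × Z' → Y} (h : MeasurePreserving ψ (ν.prod ρ) ν)
    (h' : MeasurePreserving ψ' (ν.prod ρ') ν) :
    MeasurePreserving (fun p : Y × Z × Z' => ψ' (ψ (p.1, p.2.1), p.2.2)) (ν.prod (ρ.prod ρ')) ν :=
  h'.comp ((h.prod (MeasurePreserving.id ρ')).comp measurePreserving_prodAssoc.symm)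

theorem infinitePi_preimage_update {ι : Type*} [DecidableEq ι] [IsProbabilityMeasure μ]
    {f : X → X} (hf : Measurable f) (i : ι) (s : Finset ι) {t : ι → Set X}
    (ht : ∀ k, MeasurableSet (t k)) :
    (Measure.infinitePi fun _ : ι => μ)
        ((fun ω => Function.update ω i (f (ω i))) ⁻¹' Set.pi (s : Set ι) t) =
      ∏ k ∈ s, Function.update (fun k => μ (t k)) i (μ (f ⁻¹' t i)) k := by
  have hpi : (fun ω : ι → X => Function.update ω i (f (ω i))) ⁻¹' Set.pi (s : Set ι) t =
      Set.pi (s : Set ι) (Function.update t i (f ⁻¹' t i)) := by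
    ext ω
    refine forall₂_congr fun k _ => ?_
    rcases eq_or_ne k i with rfl | hk
    · simp
    · simp [hk]
  rw [hpi, Measure.infinitePi_pi]
  · exact Finset.prod_congr rfl fun k _ =>
      Function.apply_update (fun _ A => μ A) t i (f ⁻¹' t i) k
  · intro k _
    rcases eq_or_ne k i with rfl | hk
    · simpa using hf (ht k)
    · simpa [hk] using ht k

theorem measurePreserving_resample_infinitePi {ι : Type*} [DecidableEq ι] [IsProbabilityMeasure μ]
    [IsProbabilityMeasure ρ] {φ : X × Z → X} (h : MeasurePreserving φ (μ.prod ρ) μ) (i : ι) :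
    MeasurePreserving (fun p : (ι → X) × Z => Function.update p.1 i (φ (p.1 i, p.2)))
      ((Measure.infinitePi fun _ : ι => μ).prod ρ) (Measure.infinitePi fun _ : ι => μ) := by
  have hmeas : Measurable fun p : (ι → X) × Z => Function.update p.1 i (φ (p.1 i, p.2)) :=
    measurable_update'.comp (measurable_fst.prodMk
      (h.measurable.comp (((measurable_pi_apply i).comp measurable_fst).prodMk measurable_snd)))
  refine ⟨hmeas, Measure.eq_infinitePi _ fun s t ht => ?_⟩
  have hbox : MeasurableSet (Set.pi (s : Set ι) t) :=
    MeasurableSet.pi s.countable_toSet fun k _ => ht k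
  have hfiber : ∀ z : Z, (Measure.infinitePi fun _ : ι => μ) ((fun ω : ι → X => (ω, z)) ⁻¹'
      ((fun p : (ι → X) × Z => Function.update p.1 i (φ (p.1 i, p.2))) ⁻¹' Set.pi (s : Set ι) t)) =
      ∏ k ∈ s, Function.update (fun k => μ (t k)) i (μ {x | φ (x, z) ∈ t i}) k := fun z =>
    infinitePi_preimage_update (h.measurable.comp measurable_prodMk_right) i s ht
  rw [Measure.map_apply hmeas hbox, Measure.prod_apply_symm (hmeas hbox)]
  simp only [hfiber]
  by_cases hi : i ∈ s
  · have htop : ∏ k ∈ s \ {i}, μ (t k) ≠ ⊤ :=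
      (ENNReal.prod_lt_top fun k _ => measure_lt_top _ _).ne
    have hint : ∫⁻ z, μ {x | φ (x, z) ∈ t i} ∂ρ = μ (t i) := by
      rw [← h.measure_preimage (ht i).nullMeasurableSet,
        Measure.prod_apply_symm (h.measurable (ht i))]
      rfl
    simp only [Finset.prod_update_of_mem hi]
    rw [lintegral_mul_const' _ _ htop, hint, ← Finset.prod_update_of_mem hi,
      Function.update_eq_self]
  · simp [Finset.prod_update_of_notMem hi]

end MeasurePreserving

/-- Replace the size of job `j`. -/
def setSize (j : ℕ) (p : Sample × ℝ≥0) : Sample :=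
  (p.1.1, p.1.2.1, Function.update p.1.2.2.1 j p.2, p.1.2.2.2)

/-- Replace the randomization variable number `j` of kind `i`. -/
def setUnif (i : Fin 8) (j : ℕ) (p : Sample × unitInterval) : Sample :=
  (p.1.1, p.1.2.1, p.1.2.2.1,
    Function.update p.1.2.2.2 i (Function.update (p.1.2.2.2 i) j p.2))

/-- Replace the size of job `j` and the variables used for its routing. -/
def resample (j : ℕ) (p : Sample × ℝ≥0 × unitInterval × unitInterval) : Sample :=
  setUnif 1 j (setUnif 0 j (setSize j (p.1, p.2.1), p.2.2.1), p.2.2.2)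

section Resample

instance isProbabilityMeasure_unitExp : IsProbabilityMeasure unitExp :=
  have := isProbabilityMeasure_expMeasure one_pos
  Measure.isProbabilityMeasure_map measurable_real_toNNReal.aemeasurable

variable (G F : Measure ℝ≥0) [IsProbabilityMeasure G] [IsProbabilityMeasure F]

instance isProbabilityMeasure_baseLaw : IsProbabilityMeasure (baseLaw G F) := by
  unfold baseLaw; infer_instance

theorem measurePreserving_update {X : Type*} [MeasurableSpace X] (μ : Measure X)
    [IsProbabilityMeasure μ] (j : ℕ) :
    MeasurePreserving (fun p : (ℕ → X) × X => Function.update p.1 j p.2)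
      ((Measure.infinitePi fun _ : ℕ => μ).prod μ) (Measure.infinitePi fun _ : ℕ => μ) :=
  measurePreserving_resample_infinitePi (φ := Prod.snd) (μ := μ) measurePreserving_snd j

theorem measurePreserving_setSize (j : ℕ) :
    MeasurePreserving (setSize j) ((baseLaw G F).prod F) (baseLaw G F) :=
  measurePreserving_resample_snd (measurePreserving_resample_snd
    (measurePreserving_resample_fst (measurePreserving_update F j)))

theorem measurePreserving_setUnif (i : Fin 8) (j : ℕ) :
    MeasurePreserving (setUnif i j) ((baseLaw G F).prod volume) (baseLaw G F) := by
  have h := measurePreserving_resample_infinitePi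
    (measurePreserving_update (volume : Measure unitInterval) j) i
  rw [Measure.infinitePi_eq_pi] at h
  exact measurePreserving_resample_snd (measurePreserving_resample_snd
    (measurePreserving_resample_snd h))

theorem measurePreserving_resample (j : ℕ) :
    MeasurePreserving (resample j) ((baseLaw G F).prod (F.prod (volume.prod volume)))
      (baseLaw G F) :=
  measurePreserving_resample_comp (measurePreserving_setSize G F j)
    (measurePreserving_resample_comp (measurePreserving_setUnif G F 0 j)
      (measurePreserving_setUnif G F 1 j))

variable (j : ℕ) (p : Sample × ℝ≥0 × unitInterval × unitInterval)

theorem jobSize_resample_self : jobSize (resample j p) j = p.2.1 := by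
  simp [jobSize, resample, setSize, setUnif]

theorem unif_zero_resample_self : unif (resample j p) 0 j = p.2.2.1 := by
  simp [unif, resample, setUnif]

theorem unif_one_resample_self : unif (resample j p) 1 j = p.2.2.2 := by
  simp [unif, resample, setUnif]

end Resample

/-- Two samples differ at most in the size of job `j` and the variables used for its routing. -/
structure AgreeOff (j : ℕ) (ω ω' : Sample) : Prop where
  interarrival : ω.1 = ω'.1
  message : ω.2.1 = ω'.2.1
  size : ∀ k ≠ j, jobSize ω k = jobSize ω' k
  randomization : ∀ i k, (k ≠ j ∨ (i ≠ 0 ∧ i ≠ 1)) → unif ω i k = unif ω' i k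

theorem AgreeOff.symm {j : ℕ} {ω ω' : Sample} (h : AgreeOff j ω ω') : AgreeOff j ω' ω :=
  ⟨h.interarrival.symm, h.message.symm, fun k hk => (h.size k hk).symm,
    fun i k hk => (h.randomization i k hk).symm⟩

theorem agreeOff_resample (j : ℕ) (p : Sample × ℝ≥0 × unitInterval × unitInterval) :
    AgreeOff j p.1 (resample j p) where
  interarrival := rfl
  message := rfl
  size k hk := by simp [jobSize, resample, setSize, setUnif, hk]
  randomization i k hk := by
    rcases eq_or_ne k j with rfl | hkj
    · obtain ⟨hzero, hone⟩ := hk.resolve_left (not_not_intro rfl)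
      simp [unif, resample, setSize, setUnif, hzero, hone]
    · simp only [unif, resample, setSize, setUnif, Function.update_apply]
      split_ifs <;> simp_all

section AgreeOff

variable {n c : ℕ} {P : Policy n c} {μ : Fin n → ℝ≥0} {j : ℕ} {ω ω' : Sample}

theorem AgreeOff.arrivalTime_eq (h : AgreeOff j ω ω') (z : ℝ≥0) :
    arrivalTime z ω' = arrivalTime z ω := by
  funext k; simp only [arrivalTime, h.interarrival]

theorem AgreeOff.messageTime_eq (h : AgreeOff j ω ω') (β : ℝ≥0) :
    messageTime β ω' = messageTime β ω := by
  funext k; simp only [messageTime, h.message]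

theorem AgreeOff.arrivalNext_iff (h : AgreeOff j ω ω') (z : ℝ≥0) (C : Config n c) :
    ArrivalNext P μ z ω' C ↔ ArrivalNext P μ z ω C := by
  rw [ArrivalNext, ArrivalNext, h.arrivalTime_eq, h.messageTime_eq]

theorem AgreeOff.step_eq_step (h : AgreeOff j ω ω') {z : ℝ≥0} {C : Config n c}
    (hC : ¬ (C.arr = j ∧ ArrivalNext P μ z ω C)) : step P μ z ω' C = step P μ z ω C := by
  classical
  have hunif : ∀ i k, i ≠ 0 ∧ i ≠ 1 → unif ω' i k = unif ω i k :=
    fun i k hi => (h.randomization i k (Or.inr hi)).symm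
  rw [step_eq, step_eq, h.arrivalTime_eq, h.messageTime_eq]
  by_cases hnext : ArrivalNext P μ z ω C
  · have hj : C.arr ≠ j := fun hj => hC ⟨hj, hnext⟩
    rw [if_pos hnext, if_pos ((h.arrivalNext_iff z C).2 hnext)]
    simp only [onArrival, h.size _ hj, h.randomization _ _ (Or.inl hj)]
  · rw [if_neg hnext, if_neg (mt (h.arrivalNext_iff z C).1 hnext)]
    simp only [onMessage, onDeparture, hunif 3 _ (by decide), hunif 4 _ (by decide),
      hunif 5 _ (by decide), hunif 6 _ (by decide), hunif 7 _ (by decide)]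

theorem AgreeOff.configAfter_eq (h : AgreeOff j ω ω') (x : State n c) {k : ℕ}
    (hk : (configAfter P μ x ω k).arr ≤ j) :
    configAfter P μ x ω' k = configAfter P μ x ω k := by
  induction k with
  | zero => rfl
  | succ k ih =>
    rw [configAfter_succ, configAfter_succ, ih ((arr_mono P μ x ω (Nat.le_succ k)).trans hk)]
    refine h.step_eq_step ?_
    rintro ⟨hj, hnext⟩
    rw [configAfter_succ, step_of_arrivalNext hnext, onArrival] at hk
    lia

theorem AgreeOff.preIndices_subset (h : AgreeOff j ω ω') (x : State n c) {i : ℕ}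
    (hi : i ≤ j) :
    preIndices P μ x ω i ⊆ preIndices P μ x ω' i := by
  rintro k ⟨hk, hnext⟩
  have hconfig := h.configAfter_eq x (hk.trans_le hi)
  exact ⟨hconfig ▸ hk, by rwa [hconfig, h.arrivalNext_iff]⟩

theorem AgreeOff.preState_eq (h : AgreeOff j ω ω') (x : State n c) {i : ℕ}
    (hi : i ≤ j) :
    preState P μ x ω' i = preState P μ x ω i := by
  have hindices : preIndices P μ x ω' i = preIndices P μ x ω i :=
    (h.symm.preIndices_subset x hi).antisymm (h.preIndices_subset x hi)
  have hindex : preIndex P μ x ω' i = preIndex P μ x ω i := by rw [preIndex, preIndex, hindices]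
  have hconfig : configAfter P μ x ω' (preIndex P μ x ω i) =
      configAfter P μ x ω (preIndex P μ x ω i) := by
    refine h.configAfter_eq x ?_
    rcases (preIndices P μ x ω i).eq_empty_or_nonempty with hempty | hne
    · simp [preIndex, hempty, configAfter]
    · exact (Nat.sInf_mem hne).1.trans_le hi
  rw [preState, preState, hindex, hconfig, h.arrivalTime_eq]

theorem measurable_sInf_nat {α : Type*} [MeasurableSpace α] {S : α → Set ℕ}
    (hS : ∀ k, MeasurableSet {a | k ∈ S a}) : Measurable fun a => sInf (S a) := by
  classical
  have hexists : ∀ a, ∃ k, k ∈ S a ∨ S a = ∅ := fun a => by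
    rcases (S a).eq_empty_or_nonempty with h | ⟨k, hk⟩
    exacts [⟨0, Or.inr h⟩, ⟨k, Or.inl hk⟩]
  have hfind : ∀ a, sInf (S a) = Nat.find (hexists a) := fun a => by
    rcases (S a).eq_empty_or_nonempty with h | h
    · simp [h, eq_comm (a := 0), Nat.find_eq_zero]
    · simp [Nat.sInf_def h, h.ne_empty]
  have hempty : MeasurableSet {a | S a = ∅} := by
    simp only [Set.eq_empty_iff_forall_notMem, Set.ofPred_forall]
    exact MeasurableSet.iInter fun k => (hS k).compl
  simp only [hfind]
  exact measurable_find hexists fun k => (hS k).union hempty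

theorem measurable_preState (P : Policy n c) (μ : Fin n → ℝ≥0) (x : State n c) (j : ℕ) :
    Measurable fun ω => preState P μ x ω j := by
  have hindex : Measurable fun ω => preIndex P μ x ω j :=
    measurable_sInf_nat fun k =>
      (measurableSet_eq_fun (measurable_arr (measurable_configAfter P μ x k))
        measurable_const).inter
        (measurableSet_arrivalNext P μ x.2.2 measurable_id (measurable_configAfter P μ x k))
  refine measurable_comp_index (f := fun k ω => flow μ
    (arrivalTime x.2.2 ω j - (configAfter P μ x ω k).time) (configAfter P μ x ω k).state)
    (fun k => ?_) hindex
  fun_prop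

end AgreeOff

/-! ### Sums of bounded increments with nonnegative conditional means -/

theorem mgf_neg_le {Ω : Type*} [MeasurableSpace Ω] {Pr : Measure Ω} [IsProbabilityMeasure Pr]
    {X : Ω → ℝ} {B : ℝ} (hX : AEMeasurable X Pr) (hB : ∀ ω, |X ω| ≤ B) (hmean : 0 ≤ ∫ ω, X ω ∂Pr)
    {θ : ℝ} (hθ : 0 ≤ θ) : mgf X Pr (-θ) ≤ Real.exp (B ^ 2 * θ ^ 2 / 2) := by
  have hoeffding := (hasSubgaussianMGF_of_mem_Icc hX
    (ae_of_all _ fun ω => abs_le.1 (hB ω))).mgf_le (-θ)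
  have hvariance : (((‖B - -B‖₊ / 2) ^ 2 : ℝ≥0) : ℝ) * (-θ) ^ 2 / 2 = B ^ 2 * θ ^ 2 / 2 := by
    push_cast
    rw [Real.norm_eq_abs, div_pow, sq_abs]
    ring
  rw [hvariance] at hoeffding
  calc mgf X Pr (-θ) = mgf (fun ω => X ω - ∫ ω, X ω ∂Pr) Pr (-θ) *
        Real.exp (-θ * ∫ ω, X ω ∂Pr) := by
        rw [← mgf_add_const]; simp
    _ ≤ mgf (fun ω => X ω - ∫ ω, X ω ∂Pr) Pr (-θ) * 1 := by
        refine mul_le_mul_of_nonneg_left (Real.exp_le_one_iff.2 ?_) mgf_nonneg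
        nlinarith
    _ ≤ Real.exp (B ^ 2 * θ ^ 2 / 2) := by rwa [mul_one]

/-- Increments `Y j` bounded by `B` whose mean given `Y 0, …, Y (j - 1)` is nonnegative.
Conditioning on the past is expressed by a measure-preserving map `R j` that redraws, with the help
of an independent variable of law `ρ`, the randomness specific to the index `j`. -/
structure SubmartingaleIncrements {Ω Ξ : Type*} [MeasurableSpace Ω] [MeasurableSpace Ξ]
    (Pr : Measure Ω) (ρ : Measure Ξ) (R : ℕ → Ω × Ξ → Ω) (Y : ℕ → Ω → ℝ) (B : ℝ) : Prop where
  measurePreserving : ∀ j, MeasurePreserving (R j) (Pr.prod ρ) Pr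
  measurable : ∀ j, Measurable (Y j)
  abs_le : ∀ j ω, |Y j ω| ≤ B
  past : ∀ i j, i < j → ∀ p, Y i (R j p) = Y i p.1
  mean_nonneg : ∀ j ω, 0 ≤ ∫ ξ, Y j (R j (ω, ξ)) ∂ρ

namespace SubmartingaleIncrements

variable {Ω Ξ : Type*} [MeasurableSpace Ω] [MeasurableSpace Ξ] {Pr : Measure Ω}
  [IsProbabilityMeasure Pr] {ρ : Measure Ξ} {R : ℕ → Ω × Ξ → Ω}
  {Y : ℕ → Ω → ℝ} {B : ℝ}

theorem integrable_exp_sum (h : SubmartingaleIncrements Pr ρ R Y B) (θ : ℝ) (K : ℕ) :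
    Integrable (fun ω => Real.exp (θ * ∑ j ∈ Finset.range K, Y j ω)) Pr := by
  have hmeas : Measurable fun ω => ∑ j ∈ Finset.range K, Y j ω :=
    Finset.measurable_sum _ fun j _ => h.measurable j
  refine Integrable.of_bound (hmeas.const_mul θ).exp.aestronglyMeasurable
    (Real.exp (|θ| * (K * B))) (ae_of_all _ fun ω => ?_)
  rw [Real.norm_eq_abs, Real.abs_exp]
  refine Real.exp_le_exp.2 ((le_abs_self _).trans ?_)
  rw [abs_mul]
  gcongr
  calc |∑ j ∈ Finset.range K, Y j ω| ≤ ∑ j ∈ Finset.range K, |Y j ω| :=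
        Finset.abs_sum_le_sum_abs _ _
    _ ≤ ∑ _j ∈ Finset.range K, B := Finset.sum_le_sum fun j _ => h.abs_le j ω
    _ = K * B := by simp

variable [IsProbabilityMeasure ρ]

theorem mgf_sum_succ_le (h : SubmartingaleIncrements Pr ρ R Y B) {θ : ℝ} (hθ : 0 ≤ θ) (K : ℕ) :
    mgf (fun ω => ∑ j ∈ Finset.range (K + 1), Y j ω) Pr (-θ) ≤
      mgf (fun ω => ∑ j ∈ Finset.range K, Y j ω) Pr (-θ) * Real.exp (B ^ 2 * θ ^ 2 / 2) := by
  set S : ℕ → Ω → ℝ := fun K ω => ∑ j ∈ Finset.range K, Y j ω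
  have hR := h.measurePreserving K
  have hsplit : ∀ ω ξ, Real.exp (-θ * S (K + 1) (R K (ω, ξ))) =
      Real.exp (-θ * S K ω) * Real.exp (-θ * Y K (R K (ω, ξ))) := by
    intro ω ξ
    rw [← Real.exp_add, ← mul_add]
    congr 2
    refine (Finset.sum_range_succ _ _).trans (congrArg₂ _ (Finset.sum_congr rfl fun i hi => ?_) rfl)
    exact h.past i K (Finset.mem_range.1 hi) (ω, ξ)
  calc ∫ ω, Real.exp (-θ * S (K + 1) ω) ∂Pr
      = ∫ p, Real.exp (-θ * S (K + 1) (R K p)) ∂(Pr.prod ρ) := by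
        conv_lhs => rw [← hR.map_eq]
        refine integral_map hR.aemeasurable ?_
        rw [hR.map_eq]
        exact (h.integrable_exp_sum (-θ) (K + 1)).aestronglyMeasurable
    _ = ∫ ω, Real.exp (-θ * S K ω) * mgf (fun ξ => Y K (R K (ω, ξ))) ρ (-θ) ∂Pr := by
        refine (integral_prod _ (hR.integrable_comp_of_integrable
          (h.integrable_exp_sum (-θ) (K + 1)))).trans (integral_congr_ae (ae_of_all _ fun ω => ?_))
        exact (integral_congr_ae (ae_of_all _ (hsplit ω))).trans (integral_const_mul _ _)
    _ ≤ ∫ ω, Real.exp (-θ * S K ω) * Real.exp (B ^ 2 * θ ^ 2 / 2) ∂Pr := by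
        refine integral_mono_of_nonneg
          (ae_of_all _ fun ω => mul_nonneg (Real.exp_pos _).le mgf_nonneg)
          ((h.integrable_exp_sum (-θ) K).mul_const _)
          (ae_of_all _ fun ω => mul_le_mul_of_nonneg_left ?_ (Real.exp_pos _).le)
        exact mgf_neg_le (((h.measurable K).comp hR.measurable).comp
          measurable_prodMk_left).aemeasurable (fun ξ => h.abs_le K _) (h.mean_nonneg K ω) hθ
    _ = _ := integral_mul_const _ _

theorem mgf_sum_le (h : SubmartingaleIncrements Pr ρ R Y B) {θ : ℝ} (hθ : 0 ≤ θ) (K : ℕ) :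
    mgf (fun ω => ∑ j ∈ Finset.range K, Y j ω) Pr (-θ) ≤ Real.exp (B ^ 2 * θ ^ 2 / 2) ^ K := by
  induction K with
  | zero => simp [mgf]
  | succ K ih =>
    rw [pow_succ]
    exact (h.mgf_sum_succ_le hθ K).trans (by gcongr)

theorem measureReal_sum_le (h : SubmartingaleIncrements Pr ρ R Y B) (hB : 0 < B) {δ : ℝ}
    (hδ : 0 ≤ δ) (K : ℕ) : Pr.real {ω | ∑ j ∈ Finset.range K, Y j ω ≤ -(δ * K)} ≤
      Real.exp (-(δ ^ 2 / (2 * B ^ 2))) ^ K := by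
  -- the exponent minimizing the Chernoff bound
  set θ := δ / B ^ 2 with hθ_def
  have hθ : 0 ≤ θ := by positivity
  calc _ ≤ Real.exp (- -θ * -(δ * K)) * mgf (fun ω => ∑ j ∈ Finset.range K, Y j ω) Pr (-θ) :=
        measure_le_le_exp_mul_mgf _ (neg_nonpos.2 hθ) (h.integrable_exp_sum (-θ) K)
    _ ≤ Real.exp (- -θ * -(δ * K)) * Real.exp (B ^ 2 * θ ^ 2 / 2) ^ K := by
        gcongr
        exact h.mgf_sum_le hθ K
    _ = Real.exp (-(δ ^ 2 / (2 * B ^ 2))) ^ K := by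
        rw [← Real.exp_nat_mul, ← Real.exp_nat_mul, ← Real.exp_add, hθ_def]
        congr 1
        field_simp
        ring

theorem ae_eventually_le_sum (h : SubmartingaleIncrements Pr ρ R Y B) {δ : ℝ} (hδ : 0 < δ) :
    ∀ᵐ ω ∂Pr, ∀ᶠ K : ℕ in atTop, -(δ * K) ≤ ∑ j ∈ Finset.range K, Y j ω := by
  have h' : SubmartingaleIncrements Pr ρ R Y (|B| + 1) :=
    { h with abs_le := fun j ω => (h.abs_le j ω).trans ((le_abs_self B).trans (by linarith)) }
  have hgeometric : Summable fun K : ℕ => Real.exp (-(δ ^ 2 / (2 * (|B| + 1) ^ 2))) ^ K :=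
    summable_geometric_of_lt_one (Real.exp_pos _).le
      (Real.exp_lt_one_iff.2 (neg_neg_of_pos (by positivity)))
  have hsum : ∑' K : ℕ, Pr {ω | ∑ j ∈ Finset.range K, Y j ω ≤ -(δ * K)} ≠ ⊤ := by
    refine ne_top_of_le_ne_top hgeometric.tsum_ofReal_ne_top (ENNReal.tsum_le_tsum fun K => ?_)
    rw [← ofReal_measureReal]
    exact ENNReal.ofReal_le_ofReal (h'.measureReal_sum_le (by positivity) hδ.le K)
  filter_upwards [ae_eventually_notMem hsum] with ω hω
  filter_upwards [hω] with K hK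
  exact (not_le.1 hK).le

end SubmartingaleIncrements

/-! ### Jobs sent to a given half of the servers -/

section Gain

variable {n c : ℕ} (P : Policy n c) (μ : Fin n → ℝ≥0) (N : Finset (Fin n)) (w₀ : ℝ≥0) {b : ℝ}

/-- Contribution of an arrival in state `s` to the drift, for a job of size `ξ.1` routed with the
randomization variables `ξ.2`: the indicator that the size is at least `w₀` and the destination lies
in `N`, plus `b` times the number of queried servers. -/
noncomputable def gain (b : ℝ) (s : State n c) (ξ : ℝ≥0 × unitInterval × unitInterval) : ℝ :=
  (if w₀ ≤ ξ.1 ∧ destination P μ s ξ.1 ξ.2.1 ξ.2.2 ∈ N then 1 else 0) +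
    b * (queried P s ξ.1 ξ.2.1).card

theorem measurable_gain (b : ℝ) :
    Measurable fun y : State n c × ℝ≥0 × unitInterval × unitInterval =>
      gain P μ N w₀ b y.1 y.2 := by
  have hs : Measurable fun y : State n c × ℝ≥0 × unitInterval × unitInterval => y.1 :=
    measurable_fst
  have hξ : Measurable fun y : State n c × ℝ≥0 × unitInterval × unitInterval => y.2 :=
    measurable_snd
  have hqueried := P.measurable_f₁.comp (hs.snd.fst.prodMk (hξ.fst.prodMk hξ.snd.fst))
  have hdestination := P.measurable_f₂.comp (hs.snd.fst.prodMk (hξ.fst.prodMk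
    ((measurable_report μ hs.fst hqueried).prodMk hξ.snd.snd)))
  refine Measurable.add (Measurable.ite ?_ measurable_const measurable_const) ?_
  · exact (measurableSet_le measurable_const hξ.fst).inter (hdestination N.measurableSet)
  · exact ((measurable_of_countable fun S : Finset (Fin n) => (S.card : ℝ)).comp
      hqueried).const_mul b

theorem gain_nonneg (hb : 0 ≤ b) (s : State n c) (ξ : ℝ≥0 × unitInterval × unitInterval) :
    0 ≤ gain P μ N w₀ b s ξ := by
  unfold gain; positivity

theorem abs_gain_le (hb : 0 ≤ b) (s : State n c) (ξ : ℝ≥0 × unitInterval × unitInterval) :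
    |gain P μ N w₀ b s ξ| ≤ 1 + b * n := by
  rw [abs_of_nonneg (gain_nonneg P μ N w₀ hb s ξ)]
  have hcard : ((queried P s ξ.1 ξ.2.1).card : ℝ) ≤ n := by
    exact_mod_cast card_finset_fin_le (queried P s ξ.1 ξ.2.1)
  refine add_le_add ?_ (mul_le_mul_of_nonneg_left hcard hb)
  split_ifs <;> norm_num

theorem integrable_gain_comp {Ξ : Type*} [MeasurableSpace Ξ] {ρ : Measure Ξ} [IsFiniteMeasure ρ]
    (hb : 0 ≤ b) (s : State n c) {ξ : Ξ → ℝ≥0 × unitInterval × unitInterval} (hξ : Measurable ξ) :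
    Integrable (fun y => gain P μ N w₀ b s (ξ y)) ρ :=
  Integrable.of_bound ((measurable_gain P μ N w₀ b).comp
    (measurable_const.prodMk hξ)).aestronglyMeasurable (1 + b * n)
    (ae_of_all _ fun y => abs_gain_le P μ N w₀ hb s (ξ y))

variable {P N w₀}

theorem Policy.WeaklySymmetric.tangentIntercept_le_integral_gain (hP : P.WeaklySymmetric)
    (hn : 8 ≤ n) (hc : 2 ^ c < n) (hN : n ≤ 2 * N.card + 1) {x₀ : ℝ} (hx₀ : x₀ + 1 ≤ n / 4)
    (s : State n c) {w : ℝ≥0} (hw : w₀ ≤ w) :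
    tangentIntercept x₀ ≤ ∫ y, gain P μ N w₀ (tangentSlope x₀) s (w, y)
      ∂((volume : Measure unitInterval).prod volume) := by
  have hsend : ∀ S, Integrable (fun v => if P.f₂ s.2.1 w (report s.1 μ S) v ∈ N then (1 : ℝ) else 0)
      (volume : Measure unitInterval) := fun S =>
    Integrable.of_bound ((measurable_of_countable fun i : Fin n =>
      if i ∈ N then (1 : ℝ) else 0).comp (P.measurable_f₂.comp (measurable_const.prodMk
        (measurable_const.prodMk (measurable_const.prodMk measurable_id))))).aestronglyMeasurable 1
      (ae_of_all _ fun v => by split_ifs <;> simp)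
  rw [integral_prod _ (integrable_gain_comp P μ N w₀ (tangentSlope_pos x₀).le s
    measurable_prodMk_left)]
  refine (hP.tangentIntercept_le_integral hn hc s.2.1 w s.1 μ hN hx₀).trans_eq
    (integral_congr_ae (ae_of_all _ fun u => ?_))
  simp only [gain, hw, true_and, queried, destination]
  rw [integral_add (hsend _) (integrable_const _), integral_const, probReal_univ, one_smul]

theorem Policy.WeaklySymmetric.le_integral_gain (hP : P.WeaklySymmetric) (hn : 8 ≤ n)
    (hc : 2 ^ c < n) (hN : n ≤ 2 * N.card + 1) {x₀ : ℝ} (hx₀ : x₀ + 1 ≤ n / 4)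
    (F : Measure ℝ≥0) [IsProbabilityMeasure F] (s : State n c) :
    F.real (Set.Ici w₀) * tangentIntercept x₀ ≤
      ∫ ξ, gain P μ N w₀ (tangentSlope x₀) s ξ ∂(F.prod (volume.prod volume)) := by
  have hb := (tangentSlope_pos x₀).le
  have hint : Integrable (gain P μ N w₀ (tangentSlope x₀) s) (F.prod (volume.prod volume)) :=
    integrable_gain_comp P μ N w₀ hb s measurable_id
  calc F.real (Set.Ici w₀) * tangentIntercept x₀
      = ∫ w, Set.indicator (Set.Ici w₀) (fun _ => tangentIntercept x₀) w ∂F := by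
        rw [integral_indicator measurableSet_Ici, setIntegral_const, smul_eq_mul]
    _ ≤ ∫ w, ∫ y, gain P μ N w₀ (tangentSlope x₀) s (w, y) ∂(volume.prod volume) ∂F := by
        refine integral_mono ((integrable_const _).indicator measurableSet_Ici)
          hint.integral_prod_left (Set.indicator_le' (fun w hw => ?_) fun w _ => ?_)
        · exact hP.tangentIntercept_le_integral_gain μ hn hc hN hx₀ s hw
        · exact integral_nonneg fun y => gain_nonneg P μ N w₀ hb s (w, y)
    _ = _ := (integral_prod _ hint).symm

theorem Policy.WeaklySymmetric.submartingaleIncrements_gain (hP : P.WeaklySymmetric) (hn : 8 ≤ n)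
    (hc : 2 ^ c < n) (hN : n ≤ 2 * N.card + 1) {x₀ : ℝ} (hx₀ : x₀ + 1 ≤ n / 4)
    (G F : Measure ℝ≥0) [IsProbabilityMeasure G] [IsProbabilityMeasure F] (x : State n c) :
    SubmartingaleIncrements (baseLaw G F) (F.prod (volume.prod volume)) resample
      (fun j ω => gain P μ N w₀ (tangentSlope x₀) (preState P μ x ω j)
        (jobSize ω j, unif ω 0 j, unif ω 1 j) - F.real (Set.Ici w₀) * tangentIntercept x₀)
      (1 + tangentSlope x₀ * n + |F.real (Set.Ici w₀) * tangentIntercept x₀|) where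
  measurePreserving := measurePreserving_resample G F
  measurable j := ((measurable_gain P μ N w₀ _).comp ((measurable_preState P μ x j).prodMk
    ((measurable_jobSize measurable_id measurable_const).prodMk
      ((measurable_unif 0 measurable_id measurable_const).prodMk
        (measurable_unif 1 measurable_id measurable_const))))).sub_const _
  abs_le j ω := (abs_sub _ _).trans
    (add_le_add (abs_gain_le P μ N w₀ (tangentSlope_pos x₀).le _ _) le_rfl)
  past i j hij p := by
    have hoff := agreeOff_resample j p
    simp only [hoff.preState_eq x hij.le, hoff.size i hij.ne,
      hoff.randomization _ i (Or.inl hij.ne)]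
  mean_nonneg j ω := by
    have hb := (tangentSlope_pos x₀).le
    simp only [(agreeOff_resample j (ω, _)).preState_eq x le_rfl, jobSize_resample_self,
      unif_zero_resample_self, unif_one_resample_self, Prod.mk.eta]
    rw [integral_sub (integrable_gain_comp P μ N w₀ hb _ measurable_id') (integrable_const _),
      integral_const, probReal_univ, one_smul, sub_nonneg]
    exact hP.le_integral_gain μ hn hc hN hx₀ F (preState P μ x ω j)

theorem Policy.WeaklySymmetric.ae_eventually_le_sum_gain (hP : P.WeaklySymmetric) (hn : 8 ≤ n)
    (hc : 2 ^ c < n) (hN : n ≤ 2 * N.card + 1) {x₀ : ℝ} (hx₀ : x₀ + 1 ≤ n / 4)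
    (G F : Measure ℝ≥0) [IsProbabilityMeasure G] [IsProbabilityMeasure F] (x : State n c) {δ : ℝ}
    (hδ : 0 < δ) : ∀ᵐ ω ∂(baseLaw G F), ∀ᶠ K : ℕ in atTop,
      (F.real (Set.Ici w₀) * tangentIntercept x₀ - δ) * K ≤
        ∑ j ∈ Finset.range K, ((if w₀ ≤ jobSize ω j ∧ destinationAt P μ x ω j ∈ N then 1 else 0) +
          tangentSlope x₀ * (queriedAt P μ x ω j).card) := by
  filter_upwards [(hP.submartingaleIncrements_gain (w₀ := w₀) μ hn hc hN hx₀ G F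
    x).ae_eventually_le_sum hδ] with ω hω
  filter_upwards [hω] with K hK
  simp only [Finset.sum_sub_distrib, Finset.sum_const, Finset.card_range, nsmul_eq_mul] at hK
  change _ ≤ ∑ j ∈ Finset.range K, gain P μ N w₀ (tangentSlope x₀) (preState P μ x ω j)
    (jobSize ω j, unif ω 0 j, unif ω 1 j)
  linarith

end Gain

/-! ### Arrival and message times -/

theorem ae_tendsto_average {X : Type*} [MeasurableSpace X] (ν : Measure X) [IsProbabilityMeasure ν]
    {f : X → ℝ} (hf : Measurable f) (hint : Integrable f ν) :
    ∀ᵐ y ∂(Measure.infinitePi fun _ : ℕ => ν), Tendsto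
      (fun k : ℕ => (∑ i ∈ Finset.range k, f (y i)) / k) atTop (nhds (∫ y, f y ∂ν)) := by
  have heval := fun i : ℕ => measurePreserving_eval_infinitePi (fun _ : ℕ => ν) i
  have hmap : ∀ i, (Measure.infinitePi fun _ : ℕ => ν).map (fun y => f (y i)) = ν.map f :=
    fun i => (Measure.map_map hf (heval i).measurable).symm.trans (by rw [(heval i).map_eq])
  have hindep : iIndepFun (fun (i : ℕ) (y : ℕ → X) => f (y i))
      (Measure.infinitePi fun _ : ℕ => ν) :=
    iIndepFun_infinitePi (X := fun _ => f) fun _ => hf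
  have hmean : ∫ y, f (y 0) ∂(Measure.infinitePi fun _ : ℕ => ν) = ∫ y, f y ∂ν := by
    conv_rhs => rw [← (heval 0).map_eq]
    rw [integral_map (heval 0).aemeasurable hf.aestronglyMeasurable]
  have hident : ∀ i, IdentDistrib (fun y : ℕ → X => f (y i)) (fun y => f (y 0))
      (Measure.infinitePi fun _ : ℕ => ν) (Measure.infinitePi fun _ : ℕ => ν) := fun i =>
    ⟨(hf.comp (measurable_pi_apply i)).aemeasurable,
      (hf.comp (measurable_pi_apply 0)).aemeasurable, (hmap i).trans (hmap 0).symm⟩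
  have hslln := strong_law_ae_real (fun (i : ℕ) (y : ℕ → X) => f (y i))
    ((heval 0).integrable_comp_of_integrable hint) (fun i j hij => hindep.indepFun hij) hident
  rwa [hmean] at hslln

theorem exists_lt_sum_of_average {y : ℕ → ℝ≥0} {f : ℝ≥0 → ℝ} (hf : ∀ y, f y ≤ y) {m : ℝ}
    (hm : 0 < m) (h : Tendsto (fun k : ℕ => (∑ i ∈ Finset.range k, f (y i)) / k) atTop (nhds m))
    (t : ℝ≥0) : ∃ k, t < ∑ i ∈ Finset.range (k + 1), y i := by
  have hsum : Tendsto (fun k : ℕ => (∑ i ∈ Finset.range k, f (y i)) / k * k) atTop atTop :=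
    h.pos_mul_atTop hm tendsto_natCast_atTop_atTop
  obtain ⟨k, hk, hk_pos⟩ :=
    ((hsum.eventually_gt_atTop (t : ℝ)).and (eventually_ge_atTop 1)).exists
  refine ⟨k - 1, ?_⟩
  rw [Nat.sub_add_cancel hk_pos, ← NNReal.coe_lt_coe, NNReal.coe_sum]
  rw [div_mul_cancel₀ _ (by positivity)] at hk
  exact hk.trans_le (Finset.sum_le_sum fun i _ => hf _)

theorem unitExp_singleton_zero : unitExp {0} = 0 := by
  have hpre : Real.toNNReal ⁻¹' {0} = Set.Iic 0 := by
    ext y; simp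
  have hcdf := cdf_expMeasure_eq one_pos 0
  have := isProbabilityMeasure_expMeasure one_pos
  rw [cdf_eq_real] at hcdf
  rw [unitExp, Measure.map_apply measurable_real_toNNReal (measurableSet_singleton 0), hpre]
  simpa [measureReal_eq_zero_iff] using hcdf

theorem integrable_min_one (ν : Measure ℝ≥0) [IsFiniteMeasure ν] :
    Integrable (fun y : ℝ≥0 => min (y : ℝ) 1) ν :=
  Integrable.of_bound (by fun_prop) 1 (ae_of_all _ fun y => by
    rw [Real.norm_eq_abs, abs_of_nonneg (le_min y.coe_nonneg zero_le_one)]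
    exact min_le_right _ _)

theorem integral_min_one_unitExp_pos : 0 < ∫ y : ℝ≥0, min (y : ℝ) 1 ∂unitExp := by
  have hsupp : Function.support (fun y : ℝ≥0 => min (y : ℝ) 1) = {0}ᶜ := by
    ext y
    rcases eq_or_ne y 0 with rfl | hy
    · simp
    · simpa [hy] using (lt_min (NNReal.coe_pos.2 (pos_iff_ne_zero.2 hy)) one_pos).ne'
  rw [integral_pos_iff_support_of_nonneg (fun y => le_min y.2 zero_le_one)
    (integrable_min_one unitExp), hsupp, prob_compl_eq_one_sub (measurableSet_singleton 0),
    unitExp_singleton_zero, tsub_zero]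
  exact one_pos

theorem ae_tendsto_average_interarrival {G : Measure ℝ≥0} [IsProbabilityMeasure G]
    (F : Measure ℝ≥0) {m : ℝ} (hm : 0 < m)
    (hG : ∫⁻ y, (y : ℝ≥0∞) ∂G = ENNReal.ofReal m) :
    ∀ᵐ ω ∂(baseLaw G F), Tendsto
      (fun k : ℕ => (∑ i ∈ Finset.range k, (ω.1 i : ℝ)) / k) atTop (nhds m) := by
  have hmeas : Measurable fun y : ℝ≥0 => (y : ℝ) := by fun_prop
  have hlintegral : ∫⁻ y : ℝ≥0, ENNReal.ofReal (y : ℝ) ∂G = ENNReal.ofReal m := by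
    rw [← hG]; simp
  have hint : Integrable (fun y : ℝ≥0 => (y : ℝ)) G := by
    refine ⟨hmeas.aestronglyMeasurable, ?_⟩
    rw [hasFiniteIntegral_iff_ofReal (ae_of_all _ fun y => y.2), hlintegral]
    exact ENNReal.ofReal_lt_top
  have hmean : ∫ y : ℝ≥0, (y : ℝ) ∂G = m := by
    rw [integral_eq_lintegral_of_nonneg_ae (ae_of_all _ fun y => y.2)
      hmeas.aestronglyMeasurable, hlintegral, ENNReal.toReal_ofReal hm.le]
  have haverage := ae_tendsto_average G hmeas hint
  rw [hmean] at haverage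
  exact (Measure.quasiMeasurePreserving_fst :
    Measure.QuasiMeasurePreserving (fun ω : Sample => ω.1) (baseLaw G F) _).ae haverage

theorem ae_exists_lt_messageTime (G F : Measure ℝ≥0) (β : ℝ≥0) :
    ∀ᵐ ω ∂(baseLaw G F), ∀ t : ℝ≥0, ∃ k, (t : ℝ≥0∞) < messageTime β ω k := by
  have haverage := (Measure.quasiMeasurePreserving_fst.comp Measure.quasiMeasurePreserving_snd :
    Measure.QuasiMeasurePreserving (fun ω : Sample => ω.2.1) (baseLaw G F) _).ae
    (ae_tendsto_average unitExp (by fun_prop) (integrable_min_one unitExp))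
  filter_upwards [haverage] with ω hω t
  obtain ⟨k, hk⟩ := exists_lt_sum_of_average (fun y => min_le_left _ _)
    integral_min_one_unitExp_pos hω (t * β)
  refine ⟨k, ?_⟩
  rw [messageTime]
  change t * β < ∑ j ∈ Finset.range (k + 1), ω.2.1 j at hk
  rcases eq_or_ne β 0 with rfl | hβ
  · rw [ENNReal.coe_zero,
      ENNReal.div_zero (ENNReal.coe_ne_zero.2 (zero_le.trans_lt hk).ne')]
    exact ENNReal.coe_lt_top
  · rw [ENNReal.lt_div_iff_mul_lt (Or.inl (by simpa using hβ)) (Or.inl ENNReal.coe_ne_top)]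
    exact_mod_cast hk

/-! ### Growth of the workload -/

section Growth

variable {n c : ℕ} {P : Policy n c} {μ : Fin n → ℝ≥0} {N : Finset (Fin n)} {x : State n c}
  {ω : Sample}

theorem tendsto_arr_configAt (hω : NonExplosive P.β x.2.2 ω) :
    Tendsto (fun t : ℝ≥0 => (configAt P μ x t ω).arr) atTop atTop := by
  refine tendsto_atTop.2 fun k => ?_
  filter_upwards [eventually_ge_atTop (arrivalTime x.2.2 ω k)] with t ht
  by_contra! hlt
  exact (ht.trans_lt (lt_arrivalTime_configAt hω t)).not_ge (arrivalTime_mono _ _ hlt.le)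

theorem eventually_sum_card_queriedAt_le {α : ℝ} (hα : 0 < α)
    (hrate : messageRate P μ x ω ≤ ENNReal.ofReal α) :
    ∀ᶠ t : ℝ≥0 in atTop, ∑ j ∈ Finset.range (configAt P μ x t ω).arr,
      ((queriedAt P μ x ω j).card : ℝ) ≤ α * t := by
  have hlimsup : messageRate P μ x ω < ENNReal.ofReal (2 * α) :=
    hrate.trans_lt ((ENNReal.ofReal_lt_ofReal_iff (by linarith)).2 (by linarith))
  filter_upwards [eventually_lt_of_limsup_lt hlimsup, eventually_gt_atTop 0] with t hmsgs ht
  have hqueries : 2 * ∑ j ∈ Finset.range (configAt P μ x t ω).arr,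
      ((queriedAt P μ x ω j).card : ℝ) ≤ (configAt P μ x t ω).msgs := by
    exact_mod_cast two_mul_sum_card_queriedAt_le_msgs _
  rw [ENNReal.div_lt_iff (Or.inl (by simpa using ht.ne')) (Or.inl ENNReal.coe_ne_top),
    ← ENNReal.ofReal_coe_nnreal, ← ENNReal.ofReal_mul (by linarith),
    ← ENNReal.ofReal_natCast, ENNReal.ofReal_lt_ofReal_iff (by positivity)] at hmsgs
  linarith

theorem mul_sum_indicator_le_workSent (w₀ : ℝ≥0) (K : ℕ) :
    (w₀ : ℝ) * ∑ j ∈ Finset.range K,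
      (if w₀ ≤ jobSize ω j ∧ destinationAt P μ x ω j ∈ N then (1 : ℝ) else 0) ≤
      workSent P μ x ω N K := by
  rw [workSent, NNReal.coe_sum, Finset.mul_sum]
  refine Finset.sum_le_sum fun j _ => ?_
  by_cases hdestination : destinationAt P μ x ω j ∈ N
  · by_cases hsize : w₀ ≤ jobSize ω j <;> simp [hdestination, hsize]
  · simp [hdestination]

theorem eventually_le_totalWorkload (hμ : ∀ i, 0 < μ i) (hω : NonExplosive P.β x.2.2 ω)
    {r A b α : ℝ} {w₀ : ℝ≥0} (hr : 0 ≤ r) (hA : 0 ≤ A) (hb : 0 ≤ b) (hα : 0 < α)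
    (harrival : ∀ᶠ k : ℕ in atTop, r * arrivalTime x.2.2 ω k ≤ 2 * k)
    (hgain : ∀ᶠ K : ℕ in atTop, A * K ≤ ∑ j ∈ Finset.range K,
      ((if w₀ ≤ jobSize ω j ∧ destinationAt P μ x ω j ∈ N then 1 else 0) +
        b * (queriedAt P μ x ω j).card))
    (hrate : messageRate P μ x ω ≤ ENNReal.ofReal α) :
    ∀ᶠ t : ℝ≥0 in atTop,
      (w₀ * (A * r / 2 - b * α) - (∑ i ∈ N, μ i : ℝ≥0)) * t ≤ totalWorkload P μ x t ω := by
  have hlim := tendsto_arr_configAt (μ := μ) hω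
  filter_upwards [hlim.eventually harrival, hlim.eventually hgain,
    eventually_sum_card_queriedAt_le hα hrate] with t htime hsum hqueries
  set K := (configAt P μ x t ω).arr
  have hK : r * t ≤ 2 * K := (mul_le_mul_of_nonneg_left
    (NNReal.coe_le_coe.2 (lt_arrivalTime_configAt hω t).le) hr).trans htime
  have hcount : (A * r / 2 - b * α) * t ≤ ∑ j ∈ Finset.range K,
      (if w₀ ≤ jobSize ω j ∧ destinationAt P μ x ω j ∈ N then (1 : ℝ) else 0) := by
    rw [Finset.sum_add_distrib, ← Finset.mul_sum] at hsum
    have hAK := mul_le_mul_of_nonneg_left hK hA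
    have hbq := mul_le_mul_of_nonneg_left hqueries hb
    linarith
  have hwork : (workSent P μ x ω N K : ℝ) ≤
      totalWorkload P μ x t ω + (∑ i ∈ N, μ i : ℝ≥0) * t := by
    exact_mod_cast workSent_configAt_le hμ hω N t
  have hsent := (mul_le_mul_of_nonneg_left hcount w₀.coe_nonneg).trans
    (mul_sum_indicator_le_workSent w₀ K)
  linarith

end Growth

section AlmostSure

variable (F : Measure ℝ≥0) {G : Measure ℝ≥0} [IsProbabilityMeasure G] {r : ℝ}

theorem ae_exists_lt_arrivalTime (hr : 0 < r)
    (hG : ∫⁻ y, (y : ℝ≥0∞) ∂G = ENNReal.ofReal (1 / r)) (z : ℝ≥0) :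
    ∀ᵐ ω ∂(baseLaw G F), ∀ t : ℝ≥0, ∃ k, t < arrivalTime z ω k := by
  have hmean : 0 < 1 / r := by positivity
  filter_upwards [ae_tendsto_average_interarrival F hmean hG] with ω hω t
  obtain ⟨k, hk⟩ := exists_lt_sum_of_average (f := fun y => (y : ℝ)) (fun y => le_rfl) hmean hω
    (t + z)
  exact ⟨k, lt_tsub_iff_right.2 hk⟩

theorem ae_eventually_mul_arrivalTime_le (hr : 0 < r)
    (hG : ∫⁻ y, (y : ℝ≥0∞) ∂G = ENNReal.ofReal (1 / r)) (z : ℝ≥0) :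
    ∀ᵐ ω ∂(baseLaw G F), ∀ᶠ k : ℕ in atTop, r * arrivalTime z ω k ≤ 2 * k := by
  have hmean : 0 < 1 / r := by positivity
  filter_upwards [ae_tendsto_average_interarrival F hmean hG] with ω hω
  have haverage : ∀ᶠ k : ℕ in atTop,
      (∑ i ∈ Finset.range k, (ω.1 i : ℝ)) / k < 3 / 2 * (1 / r) :=
    hω.eventually_lt_const (by linarith)
  filter_upwards [(tendsto_add_atTop_nat 1).eventually haverage, eventually_ge_atTop 3]
    with k hk hk_ge
  have hk_ge' : (3 : ℝ) ≤ k := by exact_mod_cast hk_ge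
  rw [div_lt_iff₀ (by positivity)] at hk
  have hle : (arrivalTime z ω k : ℝ) ≤ ∑ i ∈ Finset.range (k + 1), (ω.1 i : ℝ) := by
    exact_mod_cast (tsub_le_self : arrivalTime z ω k ≤ ∑ i ∈ Finset.range (k + 1), ω.1 i)
  calc r * arrivalTime z ω k ≤ r * (3 / 2 * (1 / r) * ((k + 1 : ℕ) : ℝ)) :=
        mul_le_mul_of_nonneg_left (hle.trans hk.le) hr.le
    _ = 3 / 2 * (k + 1) := by push_cast; field_simp
    _ ≤ 2 * k := by linarith

variable {n c : ℕ} {P : Policy n c} {μ : Fin n → ℝ≥0} {N : Finset (Fin n)} {x : State n c}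
  {F} [IsProbabilityMeasure F]

theorem Policy.WeaklySymmetric.ae_eventually_le_totalWorkload (hP : P.WeaklySymmetric) (hn : 8 ≤ n)
    (hc : 2 ^ c < n) (hN : n ≤ 2 * N.card + 1) (hμ : ∀ i, 0 < μ i) {α p x₀ : ℝ} {w₀ : ℝ≥0}
    (hr : 0 < r) (hG : ∫⁻ y, (y : ℝ≥0∞) ∂G = ENNReal.ofReal (1 / r)) (hα : 0 < α)
    (hp : F.real (Set.Ici w₀) = p) (hp_pos : 0 < p) (hα_eq : α = x₀ * (r * p / 2))
    (hx₀ : x₀ + 1 ≤ n / 4)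
    (hrate : ∀ᵐ ω ∂(lawFrom G F x.2.2), messageRate P μ x ω ≤ ENNReal.ofReal α) :
    ∀ᵐ ω ∂(lawFrom G F x.2.2), ∀ᶠ t : ℝ≥0 in atTop,
      (w₀ * (r * p / 16 * 4 ^ (-x₀)) - (∑ i ∈ N, μ i : ℝ≥0)) * t ≤ totalWorkload P μ x t ω := by
  have hbase : ae (lawFrom G F x.2.2) ≤ ae (baseLaw G F) := cond_absolutelyContinuous.ae_le
  have hslope := tangentSlope_pos x₀
  have hx₀_pos : 0 < x₀ := by
    by_contra! hneg
    nlinarith [mul_pos hr hp_pos]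
  -- half of the drift that is left after the queries have been paid for
  set δ := p * (4 ^ (-x₀) / 8) with hδ_def
  have hδ : 0 < δ := by positivity
  have hvalue : (p * tangentIntercept x₀ - δ) * r / 2 - tangentSlope x₀ * α =
      r * p / 16 * 4 ^ (-x₀) := by
    rw [tangentIntercept, tangentSlope, hα_eq, hδ_def]; ring
  have hA : 0 ≤ p * tangentIntercept x₀ - δ := by
    have : p * tangentIntercept x₀ - δ = p * (4 ^ (-x₀) * (1 / 8 + Real.log 4 * x₀ / 4)) := by
      rw [tangentIntercept, hδ_def]; ring
    rw [this]; positivity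
  filter_upwards [hrate, hbase (hP.ae_eventually_le_sum_gain (w₀ := w₀) μ hn hc hN hx₀ G F x hδ),
    hbase (ae_exists_lt_arrivalTime F hr hG x.2.2),
    hbase (ae_eventually_mul_arrivalTime_le F hr hG x.2.2),
    hbase (ae_exists_lt_messageTime G F P.β)] with ω hmsg hgain harrival htime hmessage
  rw [hp] at hgain
  rw [← hvalue]
  exact eventually_le_totalWorkload hμ ⟨harrival, hmessage⟩ hr.le hA hslope.le hα htime hgain hmsg

end AlmostSure

section Instability

variable {n c : ℕ} {P : Policy n c} {μ : Fin n → ℝ≥0} {x : State n c}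

theorem le_workloadGrowth {ω : Sample} {r : ℝ}
    (h : ∀ᶠ t : ℝ≥0 in atTop, r * t ≤ totalWorkload P μ x t ω) :
    ENNReal.ofReal r ≤ workloadGrowth P μ x ω := by
  refine le_liminf_of_le (by isBoundedDefault) ?_
  filter_upwards [h, eventually_gt_atTop 0] with t ht ht_pos
  rw [ENNReal.le_div_iff_mul_le (Or.inl (by simpa using ht_pos.ne')) (Or.inl ENNReal.coe_ne_top),
    ← ENNReal.ofReal_coe_nnreal (p := t), ← ENNReal.ofReal_mul' t.coe_nonneg,
    ← ENNReal.ofReal_coe_nnreal]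
  exact ENNReal.ofReal_le_ofReal ht

theorem isProbabilityMeasure_lawFrom (G F : Measure ℝ≥0) [IsProbabilityMeasure G]
    [IsProbabilityMeasure F] {z : ℝ≥0} (hz : 0 < G (Set.Ioi z)) :
    IsProbabilityMeasure (lawFrom G F z) := by
  have hfirst : MeasurePreserving (fun ω : Sample => ω.1 0) (baseLaw G F) G :=
    (measurePreserving_eval_infinitePi (fun _ : ℕ => G) 0).comp measurePreserving_fst
  refine cond_isProbabilityMeasure ?_
  have hmeasure : baseLaw G F {ω : Sample | z < ω.1 0} = G (Set.Ioi z) :=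
    hfirst.measure_preimage measurableSet_Ioi.nullMeasurableSet
  rw [hmeasure]
  exact hz.ne'

theorem measurable_workloadOn (N : Finset (Fin n)) :
    Measurable (workloadOn N : State n c → ℝ≥0) :=
  Finset.measurable_sum _ fun i _ =>
    measurable_queue_sum.comp ((measurable_pi_apply i).comp measurable_fst)

theorem exists_measure_workloadOn_le_pos {φ : Measure (State n c)} (hφ : φ ≠ 0) :
    ∃ R : ℕ, 0 < φ {s | workloadOn Finset.univ s ≤ R} := by
  by_contra! hnull
  refine hφ (Measure.measure_univ_eq_zero.1 (measure_mono_null (fun s _ => ?_)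
    (measure_iUnion_null fun R => le_antisymm (hnull R) zero_le)))
  obtain ⟨R, hR⟩ := exists_nat_ge (workloadOn Finset.univ s)
  exact Set.mem_iUnion.2 ⟨R, hR⟩

theorem volume_setOf_totalWorkload_le_lt_top {ω : Sample} {r : ℝ} (hr : 0 < r)
    (h : ∀ᶠ t : ℝ≥0 in atTop, r * t ≤ totalWorkload P μ x t ω) (R : ℝ≥0) :
    volume {t : ℝ | 0 ≤ t ∧ totalWorkload P μ x t.toNNReal ω ≤ R} < ⊤ := by
  obtain ⟨T, hT⟩ := eventually_atTop.1 h
  have hsub : {t : ℝ | 0 ≤ t ∧ totalWorkload P μ x t.toNNReal ω ≤ R} ⊆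
      Set.Icc 0 (max T (R / r)) := by
    rintro t ⟨ht_nonneg, ht⟩
    refine ⟨ht_nonneg, ?_⟩
    by_contra! hlt
    obtain ⟨hTt, hRt⟩ := max_lt_iff.1 hlt
    have hgrowth := hT t.toNNReal (NNReal.le_toNNReal_of_coe_le hTt.le)
    rw [Real.coe_toNNReal t ht_nonneg] at hgrowth
    rw [div_lt_iff₀' hr] at hRt
    exact (hRt.trans_le hgrowth).not_ge (NNReal.coe_le_coe.2 ht)
  exact (measure_mono hsub).trans_lt measure_Icc_lt_top

theorem notMem_stabilityRegion {G F : Measure ℝ≥0} [IsProbabilityMeasure G]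
    [IsProbabilityMeasure F] (hx : x ∈ stateSpace n c G) {r : ℝ} (hr : 0 < r)
    (h : ∀ᵐ ω ∂(lawFrom G F x.2.2), ∀ᶠ t : ℝ≥0 in atTop, r * t ≤ totalWorkload P μ x t ω) :
    μ ∉ stabilityRegion P G F := by
  rintro ⟨-, ⟨φ, -, hφ_ne, -, hφ⟩, -⟩
  have := isProbabilityMeasure_lawFrom G F hx.2
  obtain ⟨R, hR⟩ := exists_measure_workloadOn_le_pos hφ_ne
  obtain ⟨ω, hω, hgrowth⟩ := ((hφ _ (measurableSet_le (measurable_workloadOn Finset.univ)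
    measurable_const) hR x hx).and h).exists
  exact (volume_setOf_totalWorkload_le_lt_top hr hgrowth R).ne hω

end Instability

/-! ### Rates in which half of the servers are slow -/

section SlowHalf

theorem exists_pos_measure_Ici {F : Measure ℝ≥0} (hF : ∫⁻ w, (w : ℝ≥0∞) ∂F ≠ 0) :
    ∃ w₀ : ℝ≥0, 0 < w₀ ∧ F (Set.Ici w₀) ≠ 0 := by
  contrapose! hF
  have hcover : Set.Ioi (0 : ℝ≥0) ⊆ ⋃ k : ℕ, Set.Ici (1 / ((k : ℝ≥0) + 1)) := fun w hw =>
    let ⟨k, hk⟩ := exists_nat_one_div_lt (Set.mem_Ioi.1 hw)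
    Set.mem_iUnion.2 ⟨k, hk.le⟩
  have hnull : F (Set.Ioi 0) = 0 :=
    measure_mono_null hcover (measure_iUnion_null fun k => hF _ (by positivity))
  refine (lintegral_eq_zero_iff measurable_coe_nnreal_ennreal).2 ?_
  exact measure_mono_null (fun w hw => pos_iff_ne_zero.2 (by simpa using hw)) hnull

theorem eventually_two_pow_lt {c : ℕ+ → ℕ}
    (hc : (fun n : ℕ+ => (c n : ℝ)) =o[atTop] fun n : ℕ+ => Real.log (n : ℕ)) :
    ∀ᶠ n : ℕ+ in atTop, 2 ^ c n < (n : ℕ) := by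
  filter_upwards [hc.bound one_half_pos, eventually_ge_atTop 2] with n hn hn_ge
  have hn_gt : (1 : ℝ) < (n : ℕ) := Nat.one_lt_cast.2 (show 2 ≤ (n : ℕ) from hn_ge)
  have hlog := Real.log_pos hn_gt
  rw [Real.norm_of_nonneg (Nat.cast_nonneg _), Real.norm_of_nonneg hlog.le] at hn
  have hlt : (2 : ℝ) ^ c n < (n : ℕ) := by
    calc (2 : ℝ) ^ c n ≤ Real.exp 1 ^ c n :=
          pow_le_pow_left₀ (by norm_num) (by linarith [Real.add_one_le_exp 1]) _
      _ = Real.exp (c n) := by rw [← Real.exp_nat_mul, mul_one]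
      _ < Real.exp (Real.log (n : ℕ)) := Real.exp_lt_exp.2 (by linarith)
      _ = (n : ℕ) := Real.exp_log (by linarith)
  exact_mod_cast hlt

theorem tendsto_coe_pnat_atTop : Tendsto (fun n : ℕ+ => ((n : ℕ) : ℝ)) atTop atTop :=
  tendsto_natCast_atTop_atTop.comp (tendsto_atTop.2 fun k =>
    (eventually_ge_atTop (Nat.succPNat k)).mono fun _ hn => (Nat.le_succ k).trans hn)

theorem eventually_mul_div_add_one_le {α : ℕ+ → ℝ} {κ : ℝ} (hκ : 0 < κ)
    (hα : α =o[atTop] fun n : ℕ+ => ((n : ℕ) : ℝ) ^ 2) :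
    ∀ᶠ n : ℕ+ in atTop, α n * κ / (n : ℕ) + 1 ≤ (n : ℕ) / 4 := by
  filter_upwards [hα.bound (show 0 < 1 / (8 * κ) by positivity),
    tendsto_coe_pnat_atTop.eventually_ge_atTop 8] with n hn hn_ge
  rw [Real.norm_of_nonneg (sq_nonneg ((n : ℕ) : ℝ))] at hn
  have hle : α n * κ / (n : ℕ) ≤ (n : ℕ) / 8 := by
    rw [div_le_iff₀ (by linarith)]
    calc α n * κ ≤ 1 / (8 * κ) * ((n : ℕ) : ℝ) ^ 2 * κ :=
          mul_le_mul_of_nonneg_right ((le_abs_self _).trans hn) hκ.le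
      _ = _ := by field_simp
  linarith

/-- The conditions that admissibility of a sequence imposes on its `n`-th policy, with
`c = o(log n)` weakened to `2 ^ c < n`. -/
structure AdmissibleAt {n c : ℕ} (lam α : ℝ) (F G : Measure ℝ≥0) (P : Policy n c)
    (ν : (Fin n → ℝ≥0) → Measure (State n c)) : Prop where
  arrival_prob : IsProbabilityMeasure G
  arrival_mean : ∫⁻ y, (y : ℝ≥0∞) ∂G = ENNReal.ofReal (1 / (lam * n))
  symmetric : P.WeaklySymmetric
  memory : 2 ^ c < n
  message_pos : 0 < α
  initial_prob : ∀ μ ∈ rateSet n, IsProbabilityMeasure (ν μ)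
  initial_mem : ∀ μ ∈ rateSet n, ∀ᵐ x ∂(ν μ), x ∈ stateSpace n c G
  message_rate : ∀ μ ∈ rateSet n, ∀ᵐ x ∂(ν μ), ∀ᵐ ω ∂(lawFrom G F x.2.2),
    messageRate P μ x ω ≤ ENNReal.ofReal α

theorem Admissible.eventually_admissibleAt {lam : ℝ} {α : ℕ+ → ℝ} {F : Measure ℝ≥0}
    {G : ℕ+ → Measure ℝ≥0} {c : ℕ+ → ℕ} {P : ∀ n : ℕ+, Policy n (c n)}
    {ν : ∀ n : ℕ+, (Fin n → ℝ≥0) → Measure (State n (c n))} (h : Admissible lam α F G c P ν) :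
    ∀ᶠ n : ℕ+ in atTop, AdmissibleAt lam (α n) F (G n) (P n) (ν n) := by
  filter_upwards [eventually_two_pow_lt h.memory] with n hn
  exact ⟨h.arrival_prob n, h.arrival_mean n, h.symmetric n, hn, h.message_pos n,
    h.initial_prob n, h.initial_mem n, h.message_rate n⟩

theorem AdmissibleAt.ae_eventually_le_totalWorkload {n c : ℕ} {lam α p ε : ℝ} {w₀ : ℝ≥0}
    {F G : Measure ℝ≥0} [IsProbabilityMeasure F] {P : Policy n c}
    {ν : (Fin n → ℝ≥0) → Measure (State n c)} (h : AdmissibleAt lam α F G P ν) (hlam : 0 < lam)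
    (hp : F.real (Set.Ici w₀) = p) (hp_pos : 0 < p) (hn : 8 ≤ n)
    (hα : α * (2 / (lam * p)) / n + 1 ≤ n / 4) {μ : Fin n → ℝ≥0} (hμ : μ ∈ rateSet n)
    {N : Finset (Fin n)} (hN : n / 2 ≤ N.card) (hε : (∑ i ∈ N, μ i : ℝ≥0) ≤ ε * n) :
    ∀ᵐ x ∂(ν μ), ∀ᵐ ω ∂(lawFrom G F x.2.2), ∀ᶠ t : ℝ≥0 in atTop,
      (lam * w₀ * p / 16 * Real.exp (-(2 * Real.log 4 / (lam * p) * (α / n))) - ε) * n * t ≤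
        totalWorkload P μ x t ω := by
  have := h.arrival_prob
  have : (0 : ℝ) < n := by positivity
  filter_upwards [h.message_rate μ hμ] with x hrate
  have hgrowth := h.symmetric.ae_eventually_le_totalWorkload hn h.memory (N := N) (by omega) hμ.1
    (by positivity) h.arrival_mean h.message_pos hp hp_pos
    (x₀ := α * (2 / (lam * p)) / n) (by field_simp) hα hrate
  filter_upwards [hgrowth] with ω hω
  filter_upwards [hω] with t ht
  refine le_trans (mul_le_mul_of_nonneg_right ?_ t.coe_nonneg) ht
  have hexp : (4 : ℝ) ^ (-(α * (2 / (lam * p)) / n)) =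
      Real.exp (-(2 * Real.log 4 / (lam * p) * (α / n))) := by
    rw [Real.rpow_def_of_pos (by norm_num)]
    ring_nf
  rw [hexp]
  linarith

theorem exists_growth_constants {lam : ℝ} (hlam : 0 < lam) (F : Measure ℝ≥0)
    [IsProbabilityMeasure F] (hF : ∫⁻ w, (w : ℝ≥0∞) ∂F ≠ 0) :
    ∃ a > (0 : ℝ), ∃ K > (0 : ℝ),
      ∀ (α : ℕ+ → ℝ) (G : ℕ+ → Measure ℝ≥0) (c : ℕ+ → ℕ) (P : ∀ n : ℕ+, Policy n (c n))
        (ν : ∀ n : ℕ+, (Fin n → ℝ≥0) → Measure (State n (c n))),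
        (α =o[atTop] fun n : ℕ+ => ((n : ℕ) : ℝ) ^ 2) →
        (∀ᶠ n : ℕ+ in atTop, AdmissibleAt lam (α n) F (G n) (P n) (ν n)) →
        ∀ᶠ n : ℕ+ in atTop, ∀ μ ∈ rateSet n, ∀ (ε : ℝ) (N : Finset (Fin n)),
          (n : ℕ) / 2 ≤ N.card → (∑ i ∈ N, μ i : ℝ≥0) ≤ ε * (n : ℕ) →
          (∀ᵐ x ∂(ν n μ), ∀ᵐ ω ∂(lawFrom (G n) F x.2.2),
            ENNReal.ofReal ((a * Real.exp (-(K * (α n / (n : ℕ)))) - ε) * (n : ℕ)) ≤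
              workloadGrowth (P n) μ x ω) ∧
          (ε < a * Real.exp (-(K * (α n / (n : ℕ)))) → μ ∉ stabilityRegion (P n) (G n) F) := by
  obtain ⟨w₀, hw₀, hne⟩ := exists_pos_measure_Ici hF
  obtain ⟨p, hp⟩ : ∃ p, F.real (Set.Ici w₀) = p := ⟨_, rfl⟩
  have hp_pos : 0 < p := hp ▸ ENNReal.toReal_pos hne (measure_ne_top _ _)
  refine ⟨lam * w₀ * p / 16, by positivity, 2 * Real.log 4 / (lam * p), by positivity, ?_⟩
  intro α G c P ν hα hadm
  filter_upwards [hadm, eventually_mul_div_add_one_le (κ := 2 / (lam * p)) (by positivity) hα,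
    eventually_ge_atTop (8 : ℕ+)] with n hadm_n hα_n hn μ hμ ε N hN hε
  have hgrowth := hadm_n.ae_eventually_le_totalWorkload hlam hp hp_pos hn hα_n hμ hN hε
  refine ⟨?_, fun hlt => ?_⟩
  · filter_upwards [hgrowth] with x hx
    filter_upwards [hx] with ω hω using le_workloadGrowth hω
  · have := hadm_n.arrival_prob
    have := hadm_n.initial_prob μ hμ
    obtain ⟨x, hx, hx_mem⟩ := (hgrowth.and (hadm_n.initial_mem μ hμ)).exists
    exact notMem_stabilityRegion hx_mem (mul_pos (sub_pos.2 hlt) (by positivity)) hx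

end SlowHalf

section Separation

/-- Service rates for which half of the servers have the rate `ε`, and the others share the
remaining capacity. -/
noncomputable def slowHalfRates (n : ℕ) (ε : ℝ≥0) (i : Fin n) : ℝ≥0 :=
  if (i : ℕ) < n / 2 then ε else (n - (n / 2 : ℕ) * ε) / (n - n / 2 : ℕ)

/-- The set of the servers to which `slowHalfRates n ε` assigns the rate `ε`. -/
def slowHalf (n : ℕ) : Finset (Fin n) :=
  Finset.univ.filter fun i => (i : ℕ) < n / 2

theorem card_slowHalf (n : ℕ) : (slowHalf n).card = n / 2 := by
  rw [slowHalf, Fin.card_filter_val_lt]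
  exact min_eq_right (Nat.div_le_self n 2)

theorem slowHalfRates_of_mem {n : ℕ} (ε : ℝ≥0) {i : Fin n} (hi : i ∈ slowHalf n) :
    slowHalfRates n ε i = ε :=
  if_pos (Finset.mem_filter.1 hi).2

theorem slowHalfRates_of_notMem {n : ℕ} (ε : ℝ≥0) {i : Fin n} (hi : i ∉ slowHalf n) :
    slowHalfRates n ε i = (n - (n / 2 : ℕ) * ε) / (n - n / 2 : ℕ) :=
  if_neg fun h => hi (Finset.mem_filter.2 ⟨Finset.mem_univ i, h⟩)

theorem slowHalfRates_mem_rateSet {n : ℕ} (hn : 0 < n) {ε : ℝ≥0} (hε : 0 < ε) (hε_lt : ε < 1) :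
    slowHalfRates n ε ∈ rateSet n := by
  have hlt : ((n / 2 : ℕ) : ℝ≥0) * ε < n :=
    calc ((n / 2 : ℕ) : ℝ≥0) * ε ≤ (n / 2 : ℕ) := mul_le_of_le_one_right' hε_lt.le
      _ < n := Nat.cast_lt.2 (Nat.div_lt_self hn one_lt_two)
  have hpos : (0 : ℝ≥0) < (n - n / 2 : ℕ) := Nat.cast_pos.2 (by omega)
  refine ⟨fun i => ?_, ?_⟩
  · by_cases hi : i ∈ slowHalf n
    · rwa [slowHalfRates_of_mem ε hi]
    · rw [slowHalfRates_of_notMem ε hi]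
      exact div_pos (tsub_pos_of_lt hlt) hpos
  · rw [← Finset.sum_add_sum_compl (slowHalf n),
      Finset.sum_congr rfl fun i hi => slowHalfRates_of_mem ε hi,
      Finset.sum_congr rfl fun i hi => slowHalfRates_of_notMem ε (Finset.mem_compl.1 hi),
      Finset.sum_const, Finset.sum_const, Finset.card_compl, card_slowHalf, Fintype.card_fin,
      nsmul_eq_mul, nsmul_eq_mul, mul_div_cancel₀ _ hpos.ne', add_tsub_cancel_of_le hlt.le]

theorem sum_le_mul_of_card_le_half {n : ℕ} {N : Finset (Fin n)} {μ : Fin n → ℝ≥0} {ε : ℝ≥0}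
    (hN : N.card ≤ n / 2) (hμ : ∀ i ∈ N, μ i = ε) :
    ((∑ i ∈ N, μ i : ℝ≥0) : ℝ) ≤ ε * n := by
  have hcard : (N.card : ℝ≥0) ≤ n := Nat.cast_le.2 (hN.trans (Nat.div_le_self n 2))
  rw [Finset.sum_congr rfl hμ, Finset.sum_const, nsmul_eq_mul, mul_comm]
  exact_mod_cast mul_le_mul_right hcard ε

/-- A rate that is below `a * exp (-(K * r / n))` for all `a, K > 0` and all large `n`. -/
noncomputable def tinyRate (n : ℕ) (r : ℝ) : ℝ≥0 := (Real.exp (-(n + r))).toNNReal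

theorem coe_tinyRate (n : ℕ) (r : ℝ) : (tinyRate n r : ℝ) = Real.exp (-(n + r)) :=
  Real.coe_toNNReal _ (Real.exp_pos _).le

theorem eventually_tinyRate_lt {a : ℝ} (ha : 0 < a) (K : ℝ) :
    ∀ᶠ n : ℕ+ in atTop, ∀ r > (0 : ℝ),
      (tinyRate n r : ℝ) < a * Real.exp (-(K * (r / (n : ℕ)))) := by
  filter_upwards [tendsto_coe_pnat_atTop.eventually_ge_atTop K,
    tendsto_coe_pnat_atTop.eventually_gt_atTop (-Real.log a)] with n hK hlog r hr
  have hn_pos : (0 : ℝ) < (n : ℕ) := by positivity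
  have hle : K * (r / (n : ℕ)) ≤ r := by
    rw [mul_div_assoc', div_le_iff₀ hn_pos, mul_comm]
    exact mul_le_mul_of_nonneg_left hK hr.le
  calc (tinyRate n r : ℝ) = Real.exp (-(n + r)) := coe_tinyRate n r
    _ < Real.exp (Real.log a + -(K * (r / (n : ℕ)))) := Real.exp_lt_exp.2 (by linarith)
    _ = a * Real.exp (-(K * (r / (n : ℕ)))) := by rw [Real.exp_add, Real.exp_log ha]

theorem slowHalfRates_tinyRate_mem_rateSet {n : ℕ} (hn : 0 < n) {r : ℝ} (hr : 0 < r) :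
    slowHalfRates n (tinyRate n r) ∈ rateSet n := by
  refine slowHalfRates_mem_rateSet hn (Real.toNNReal_pos.2 (Real.exp_pos _)) ?_
  rw [← NNReal.coe_lt_one, coe_tinyRate, Real.exp_lt_one_iff]
  exact neg_neg_of_pos (by positivity)

theorem eventually_stabilityRegion_subset {lam : ℝ} (hlam : 0 < lam) {α : ℕ+ → ℝ}
    (hα : α =o[atTop] fun n : ℕ+ => ((n : ℕ) : ℝ) ^ 2) {F : Measure ℝ≥0} [IsProbabilityMeasure F]
    (hF : ∫⁻ w, (w : ℝ≥0∞) ∂F ≠ 0) {G : ℕ+ → Measure ℝ≥0} {c : ℕ+ → ℕ}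
    {P : ∀ n : ℕ+, Policy n (c n)} {ν : ∀ n : ℕ+, (Fin n → ℝ≥0) → Measure (State n (c n))}
    (hadm : ∀ᶠ n : ℕ+ in atTop, AdmissibleAt lam (α n) F (G n) (P n) (ν n)) :
    ∀ᶠ n : ℕ+ in atTop, stabilityRegion (P n) (G n) F ⊆
      rateSet n \ {slowHalfRates n (tinyRate n (α n))} := by
  obtain ⟨a, ha, K, -, hgrowth⟩ := exists_growth_constants hlam F hF
  filter_upwards [hgrowth α G c P ν hα hadm, eventually_tinyRate_lt ha K, hadm]
    with n hn htiny hadm_n μ hμ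
  refine ⟨hμ.1, ?_⟩
  rintro rfl
  have hsum := sum_le_mul_of_card_le_half (card_slowHalf n).le fun _ =>
    slowHalfRates_of_mem (tinyRate n (α n))
  exact (hn _ hμ.1 _ (slowHalf n) (card_slowHalf n).ge hsum).2 (htiny _ hadm_n.message_pos) hμ

end Separation

end Dispatch

theorem theorem2p2_general :
    (∃ Γ : ∀ n : ℕ+, ℝ → Set (Fin n → ℝ≥0),
      (∀ (n : ℕ+) (r : ℝ), 0 < r → Γ n r ⊂ Dispatch.rateSet n) ∧
      ∀ lam > (0 : ℝ), ∀ (α : ℕ+ → ℝ) (F : Measure ℝ≥0) (G : ℕ+ → Measure ℝ≥0) (c : ℕ+ → ℕ)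
        (P : ∀ n : ℕ+, Dispatch.Policy n (c n))
        (ν : ∀ n : ℕ+, (Fin n → ℝ≥0) → Measure (Dispatch.State n (c n))),
        IsProbabilityMeasure F → ∫⁻ w, (w : ℝ≥0∞) ∂F ≠ 0 →
        (α =o[atTop] fun n : ℕ+ => ((n : ℕ) : ℝ) ^ 2) →
        (∀ᶠ n : ℕ+ in atTop, Dispatch.AdmissibleAt lam (α n) F (G n) (P n) (ν n)) →
        ∀ᶠ n : ℕ+ in atTop, Dispatch.stabilityRegion (P n) (G n) F ⊆ Γ n (α n)) ∧
    (∀ lam > (0 : ℝ), ∀ F : Measure ℝ≥0, IsProbabilityMeasure F → ∫⁻ w, (w : ℝ≥0∞) ∂F ≠ 0 →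
      ∃ a > (0 : ℝ), ∃ K > (0 : ℝ),
        ∀ (α : ℕ+ → ℝ) (G : ℕ+ → Measure ℝ≥0) (c : ℕ+ → ℕ)
          (P : ∀ n : ℕ+, Dispatch.Policy n (c n))
          (ν : ∀ n : ℕ+, (Fin n → ℝ≥0) → Measure (Dispatch.State n (c n))),
          (α =o[atTop] fun n : ℕ+ => ((n : ℕ) : ℝ) ^ 2) →
          (∀ᶠ n : ℕ+ in atTop, Dispatch.AdmissibleAt lam (α n) F (G n) (P n) (ν n)) →
          ∀ᶠ n : ℕ+ in atTop, ∀ μ ∈ Dispatch.rateSet n, ∀ (ε : ℝ) (N : Finset (Fin n)),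
            (n : ℕ) / 2 ≤ N.card → (∑ i ∈ N, μ i : ℝ≥0) ≤ ε * (n : ℕ) →
            (∀ᵐ x ∂(ν n μ), ∀ᵐ ω ∂(Dispatch.lawFrom (G n) F x.2.2),
              ENNReal.ofReal ((a * Real.exp (-(K * (α n / (n : ℕ)))) - ε) * (n : ℕ)) ≤
                Dispatch.workloadGrowth (P n) μ x ω) ∧
            (ε < a * Real.exp (-(K * (α n / (n : ℕ)))) →
              μ ∉ Dispatch.stabilityRegion (P n) (G n) F)) := by
  refine ⟨⟨fun n r => Dispatch.rateSet n \ {Dispatch.slowHalfRates n (Dispatch.tinyRate n r)},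
    fun n r hr => ?_, fun lam hlam α F G c P ν _ hF hα hadm =>
      Dispatch.eventually_stabilityRegion_subset hlam hα hF hadm⟩,
    fun lam hlam F _ hF => Dispatch.exists_growth_constants hlam F hF⟩
  exact (Set.ssubset_iff_of_subset Set.sdiff_subset).2
    ⟨_, Dispatch.slowHalfRates_tinyRate_mem_rateSet n.pos hr, fun h => h.2 rfl⟩

theorem theorem2p2 (lam : ℝ) (hlam₀ : 0 < lam) (hlam₁ : lam < 1) :
    (∃ Γ : ∀ n : ℕ+, ℝ → Set (Fin n → ℝ≥0),
      (∀ (n : ℕ+) (r : ℝ), 0 < r → Γ n r ⊂ Dispatch.rateSet n) ∧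
      ∀ (α : ℕ+ → ℝ) (F : Measure ℝ≥0) (G : ℕ+ → Measure ℝ≥0) (c : ℕ+ → ℕ)
        (P : ∀ n : ℕ+, Dispatch.Policy n (c n))
        (ν : ∀ n : ℕ+, (Fin n → ℝ≥0) → Measure (Dispatch.State n (c n))),
        Dispatch.Admissible lam α F G c P ν →
        ∀ᶠ n : ℕ+ in atTop, Dispatch.stabilityRegion (P n) (G n) F ⊆ Γ n (α n)) ∧
    (∀ F : Measure ℝ≥0, IsProbabilityMeasure F → ∫⁻ w, (w : ℝ≥0∞) ∂F = 1 →
      ∃ a > (0 : ℝ), ∃ K > (0 : ℝ),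
        ∀ (α : ℕ+ → ℝ) (G : ℕ+ → Measure ℝ≥0) (c : ℕ+ → ℕ)
          (P : ∀ n : ℕ+, Dispatch.Policy n (c n))
          (ν : ∀ n : ℕ+, (Fin n → ℝ≥0) → Measure (Dispatch.State n (c n))),
          Dispatch.Admissible lam α F G c P ν →
          ∀ᶠ n : ℕ+ in atTop, ∀ μ ∈ Dispatch.rateSet n, ∀ (ε : ℝ≥0) (N : Finset (Fin n)),
            N.card = (n : ℕ) / 2 → (∀ i ∈ N, μ i = ε) →
            (∀ᵐ x ∂(ν n μ), ∀ᵐ ω ∂(Dispatch.lawFrom (G n) F x.2.2),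
              ENNReal.ofReal ((a * Real.exp (-(K * (α n / (n : ℕ)))) - ε) * (n : ℕ)) ≤
                Dispatch.workloadGrowth (P n) μ x ω) ∧
            ((ε : ℝ) < a * Real.exp (-(K * (α n / (n : ℕ)))) →
              μ ∉ Dispatch.stabilityRegion (P n) (G n) F)) := by
  obtain ⟨⟨Γ, hΓ, hsubset⟩, hgrowth⟩ := theorem2p2_general
  refine ⟨⟨Γ, hΓ, fun α F G c P ν h => hsubset lam hlam₀ α F G c P ν h.job_prob
    (h.job_mean ▸ one_ne_zero) h.message_order h.eventually_admissibleAt⟩, fun F hF hmean => ?_⟩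
  obtain ⟨a, ha, K, hK, hbound⟩ := hgrowth lam hlam₀ F hF (hmean ▸ one_ne_zero)
  refine ⟨a, ha, K, hK, fun α G c P ν h => ?_⟩
  filter_upwards [hbound α G c P ν h.message_order h.eventually_admissibleAt] with n hn μ hμ ε N
    hN hε using hn μ hμ ε N hN.ge (Dispatch.sum_le_mul_of_card_le_half hN.le hε)
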